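/- Let $X$ be a compact connected Riemann surface, $D \subset X$ a finite set, and $\pi : \Sigma \to X$ a holomorphic double cover by a compact Riemann surface $\Sigma$ (every fibre has two points, counted with multiplicity). Let $R \subset \Sigma$ be the set of ramification points, and assume that the branch locus $\pi(R)$ is disjoint from $D$. Put $C = \pi^{-1}(D)$ and let $\sigma : \Sigma \to \Sigma$ be the canonical involution, which exchanges the two points of each unramified fibre and fixes $R$ pointwise. Let $\partial_R$ be the logarithmic connection on $\mathcal{O}_\Sigma(R)$ for which the canonical map $\mathcal{O}_\Sigma \to \mathcal{O}_\Sigma(R)$ is flat, i.e. the exterior derivative of meromorphic functions with at most simple poles along $R$. An odd abelian logarithmic connection on $(\Sigma, R \cup C)$ is a triple $(\mathcal{L}, \partial, \mu)$ where $\mathcal{L}$ is a holomorphic line bundle on $\Sigma$, $\partial : \mathcal{L} \to \mathcal{L} \otimes \Omega^1_\Sigma(R \cup C)$ is a $\mathbb{C}$-linear map of sheaves satisfying the Leibniz rule, and $\mu : \mathcal{L} \otimes \sigma^*\mathcal{L} \to \mathcal{O}_\Sigma(R)$ is an isomorphism which is skew-symmetric ($\sigma^*\mu = -\mu$) and intertwines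 $\partial \otimes \sigma^*\partial$ with $\partial_R$. Let $(\mathcal{L}, \partial, \mu)$ be any odd abelian logarithmic connection on $(\Sigma, R \cup C)$. Then: 1. At every ramification point $r \in R$ the residue of $\partial$ is $-1/2$, and the monodromy of $\partial$ around $r$ is $-1$. 2. Every $p \in D$ has exactly two preimages $p_-, p_+ \in C$, and $\operatorname{Res}_{p_-} \partial + \operatorname{Res}_{p_+} \partial = 0$. -/

import Mathlib

open Set Filter
open Bundle (TotalSpace)
open scoped Manifold ContDiff Topology TensorProduct

noncomputable section

namespace OddConn

/-! ### Double covers of Riemann surfaces -/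

section Cover

variable {X Y : Type*} [TopologicalSpace X] [ChartedSpace ℂ X]
  [TopologicalSpace Y] [ChartedSpace ℂ Y]

/-- The multiplicity (ramification index) of a holomorphic map `π` at `y`: the order of vanishing
at `y` of `π - π y`, read in the preferred charts at `y` and `π y`. -/
def multiplicity (π : Y → X) (y : Y) : ℕ∞ :=
  analyticOrderAt
    (fun w : ℂ => chartAt ℂ (π y) (π ((chartAt ℂ y).symm w)) - chartAt ℂ (π y) (π y))
    (chartAt ℂ y y)

/-- A double cover: a holomorphic map all of whose fibres have exactly two points, counted with
multiplicity. Multiplicities are at least `1`, so an infinite fibre would have `finsum` equal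
to `0`; in particular all fibres are finite and no multiplicity exceeds `2`. -/
structure IsDoubleCover (π : Y → X) : Prop where
  holomorphic : MDifferentiable 𝓘(ℂ) 𝓘(ℂ) π
  degree_two : ∀ x : X, ∑ᶠ y ∈ π ⁻¹' {x}, multiplicity π y = 2

/-- The ramification locus `R` of `π`. -/
def ramification (π : Y → X) : Set Y := {y | 1 < multiplicity π y}

open Classical in
/-- The canonical involution of a double cover: it exchanges the two points of every unramified
fibre and fixes the ramification points. -/
def involution (π : Y → X) (y : Y) : Y :=
  if h : ∃ y', y' ≠ y ∧ π y' = π y then h.choose else y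

end Cover

/-! ### Local coordinates and the sheaf `𝒪(R)` -/

section Functions

variable {Y : Type*} [TopologicalSpace Y] [ChartedSpace ℂ Y]

/-- The preferred local coordinate centred at `p` (only its germ at `p` is used). -/
def localCoord (p : Y) : Y → ℂ := fun y => chartAt ℂ p y - chartAt ℂ p p

/-- `g` is holomorphic near `r` and extends `z f`, where `z` is a local coordinate centred
at `r`. -/
def ExtendsMul (f : Y → ℂ) (r : Y) (g : Y → ℂ) : Prop :=
  (∀ᶠ y in 𝓝 r, MDifferentiableAt 𝓘(ℂ) 𝓘(ℂ) g y) ∧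
    ∀ᶠ y in 𝓝[≠] r, g y = localCoord r y * f y

/-- `f` is a section over `U` of `𝒪(R)`: a meromorphic function on `U`, holomorphic away from `R`,
with at most a simple pole at every point of `R`. (The value of `f` at a point of `R` is
irrelevant.) -/
def IsSectionO (R U : Set Y) (f : Y → ℂ) : Prop :=
  (∀ y ∈ U \ R, MDifferentiableAt 𝓘(ℂ) 𝓘(ℂ) f y) ∧ ∀ r ∈ U ∩ R, ∃ g, ExtendsMul f r g

/-- `f` is a section over `U` of `𝒪(R)` that generates `𝒪(R)` at every point of `U`: it does not
vanish off `R`, and at a point of `R` it is an invertible holomorphic function times `z⁻¹`. -/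
def IsGeneratorO (R U : Set Y) (f : Y → ℂ) : Prop :=
  (∀ y ∈ U \ R, MDifferentiableAt 𝓘(ℂ) 𝓘(ℂ) f y ∧ f y ≠ 0) ∧
    ∀ r ∈ U ∩ R, ∃ g, ExtendsMul f r g ∧ g r ≠ 0

/-- The canonical logarithmic connection `∂_R` on `𝒪(R)`. It is the connection for which the
canonical map `𝒪 → 𝒪(R)` is flat, i.e. the exterior derivative of sections of `𝒪(R)`, regarded as
meromorphic functions (so that `∂_R z⁻¹ = -z⁻¹ dz ⊗ z⁻¹`). -/
def canonicalConnectionO (f : Y → ℂ) (y : Y) : TangentSpace 𝓘(ℂ) y →L[ℂ] ℂ :=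
  mvfderiv 𝓘(ℂ) f y

end Functions

/-! ### Logarithmic connections on holomorphic line bundles -/

section Connections

variable {Y : Type*} [TopologicalSpace Y] [ChartedSpace ℂ Y] [IsManifold 𝓘(ℂ) 1 Y]
  {L : Y → Type*} [TopologicalSpace (TotalSpace ℂ L)]
  [∀ y, AddCommGroup (L y)] [∀ y, Module ℂ (L y)] [∀ y, TopologicalSpace (L y)]
  [∀ y, IsTopologicalAddGroup (L y)] [∀ y, ContinuousSMul ℂ (L y)]
  [FiberBundle ℂ L] [VectorBundle ℂ ℂ L]

/-- The section `s` of the line bundle `L` is complex differentiable at `y`. -/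
def SecDiffAt (s : ∀ y, L y) (y : Y) : Prop :=
  MDifferentiableAt 𝓘(ℂ) (𝓘(ℂ).prod 𝓘(ℂ)) (fun y => TotalSpace.mk' ℂ y (s y)) y

/-- `s` is a holomorphic section of `L` over the open set `U`. -/
def IsHolSection (U : Set Y) (s : ∀ y, L y) : Prop := ∀ y ∈ U, SecDiffAt s y

/-- The `L`-valued one-form `α` (a section of `T*Y ⊗ L = Hom(TY, L)`) is complex differentiable
at `y`. -/
def FormDiffAt (α : ∀ y : Y, TangentSpace 𝓘(ℂ) y →L[ℂ] L y) (y : Y) : Prop :=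
  MDifferentiableAt 𝓘(ℂ) (𝓘(ℂ).prod 𝓘(ℂ, ℂ →L[ℂ] ℂ))
    (fun y => (TotalSpace.mk' (ℂ →L[ℂ] ℂ) y (α y) :
      TotalSpace (ℂ →L[ℂ] ℂ) (fun y : Y => TangentSpace 𝓘(ℂ) y →L[ℂ] L y))) y

/-- `η` is a holomorphic `L`-valued one-form near `p` that extends `z α`, where `z` is a local
coordinate centred at `p`. -/
def ExtendsSMul (α : ∀ y : Y, TangentSpace 𝓘(ℂ) y →L[ℂ] L y) (p : Y)
    (η : ∀ y : Y, TangentSpace 𝓘(ℂ) y →L[ℂ] L y) : Prop :=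
  (∀ᶠ y in 𝓝 p, FormDiffAt η y) ∧ ∀ᶠ y in 𝓝[≠] p, η y = localCoord p y • α y

/-- `α` is a section over `U` of `L ⊗ Ω¹(P)`: an `L`-valued one-form, holomorphic away from `P`,
with at most a simple pole at every point of `P`. -/
def IsLogForm (P U : Set Y) (α : ∀ y : Y, TangentSpace 𝓘(ℂ) y →L[ℂ] L y) : Prop :=
  (∀ y ∈ U \ P, FormDiffAt α y) ∧ ∀ p ∈ U ∩ P, ∃ η, ExtendsSMul α p η

variable (L) in
/-- A logarithmic connection on `(Y, P)` on the line bundle `L`: a `ℂ`-linear map of sheaves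
`L → L ⊗ Ω¹(P)` satisfying the Leibniz rule. A section over `U` is represented by any function
`∀ y, L y` that is holomorphic on `U`, and `toFun s` represents its image over every such `U`;
`congr` says that this image over `U` depends only on the section over `U`, and so expresses
compatibility with restriction. The values of `toFun s` outside `U` and at the points of `P` carry
no information. (Homogeneity is the Leibniz rule for constant functions.) -/
structure LogConnection (P : Set Y) where
  toFun : (∀ y, L y) → ∀ y : Y, TangentSpace 𝓘(ℂ) y →L[ℂ] L y
  congr : ∀ (U : Set Y) (s t : ∀ y, L y), IsOpen U → IsHolSection U s → (∀ y ∈ U, s y = t y) →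
    ∀ y ∈ U \ P, toFun s y = toFun t y
  add : ∀ (U : Set Y) (s t : ∀ y, L y), IsOpen U → IsHolSection U s → IsHolSection U t →
    ∀ y ∈ U \ P, toFun (fun y => s y + t y) y = toFun s y + toFun t y
  leibniz : ∀ (U : Set Y) (f : Y → ℂ) (s : ∀ y, L y), IsOpen U →
    (∀ y ∈ U, MDifferentiableAt 𝓘(ℂ) 𝓘(ℂ) f y) → IsHolSection U s →
    ∀ y ∈ U \ P, ∀ v : TangentSpace 𝓘(ℂ) y,
      toFun (fun y => f y • s y) y v
        = f y • toFun s y v + mvfderiv 𝓘(ℂ) f y v • s y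
  log_pole : ∀ (U : Set Y) (s : ∀ y, L y), IsOpen U → IsHolSection U s → IsLogForm P U (toFun s)

/-- `c` is the residue of `δ` at `p`: for every holomorphic section `s` near `p`, the one-form
`z (δ s)` extends holomorphically over `p`, with value `c dz ⊗ s` there. Equivalently, the
restriction of `δ` to the fibre `L p` is multiplication by `c`. -/
def HasResidueAt {P : Set Y} (δ : LogConnection L P) (p : Y) (c : ℂ) : Prop :=
  ∀ s : ∀ y, L y, (∀ᶠ y in 𝓝 p, SecDiffAt s y) →
    ∃ η, ExtendsSMul (δ.toFun s) p η ∧ ∀ v : TangentSpace 𝓘(ℂ) p,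
      η p v = mvfderiv 𝓘(ℂ) (localCoord p) p v • c • s p

/-- `s` is a flat section of `L` over the open set `V`, which avoids the polar set. -/
def IsFlatOn {P : Set Y} (δ : LogConnection L P) (V : Set Y) (s : ∀ y, L y) : Prop :=
  IsOpen V ∧ Disjoint V P ∧ IsHolSection V s ∧ ∀ y ∈ V, δ.toFun s y = 0

/-- `S` is parallel along the path `γ : [0,1] → Y`: locally on `[0,1]` it is the restriction to `γ`
of a flat section of `L`. -/
def IsParallelAlong {P : Set Y} (δ : LogConnection L P) (γ : ℝ → Y) (S : ∀ t, L (γ t)) : Prop :=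
  ∀ t₀ ∈ Icc (0 : ℝ) 1, ∃ (V : Set Y) (s : ∀ y, L y), γ t₀ ∈ V ∧ IsFlatOn δ V s ∧
    ∀ᶠ t in 𝓝[Icc 0 1] t₀, S t = s (γ t)

/-- The loop `t ↦ w e^{2πit}`, `0 ≤ t ≤ 1`, in the preferred local coordinate centred at `p`. -/
def smallLoop (p : Y) (w : ℂ) (t : ℝ) : Y :=
  (chartAt ℂ p).symm (chartAt ℂ p p + w * Complex.exp (2 * Real.pi * Complex.I * t))

/-- The monodromy of `δ` around `p` is `m`: along every sufficiently small positively oriented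
coordinate circle around `p`, with any base point, parallel transport exists for all initial
vectors and is multiplication by `m`. -/
def HasMonodromyAt {P : Set Y} (δ : LogConnection L P) (p : Y) (m : ℂ) : Prop :=
  ∀ᶠ w in 𝓝[≠] (0 : ℂ),
    (∀ v : L (smallLoop p w 0), ∃ S : ∀ t, L (smallLoop p w t),
      IsParallelAlong δ (smallLoop p w) S ∧ S 0 = v) ∧
    ∀ S : ∀ t, L (smallLoop p w t), IsParallelAlong δ (smallLoop p w) S →
      TotalSpace.mk' ℂ (smallLoop p w 1) (S 1) = TotalSpace.mk' ℂ (smallLoop p w 0) (m • S 0)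

/-! ### Odd structures -/

/-- The section `a ⊗ σ^* b` of `L ⊗ σ^* L`. -/
def tensorPullback (σ : Y → Y) (a b : ∀ y, L y) (y : Y) : L y ⊗[ℂ] L (σ y) :=
  a y ⊗ₜ[ℂ] b (σ y)

/-- The connection `δ ⊗ σ^* δ` on `L ⊗ σ^* L`, applied to the section `a ⊗ σ^* b` and evaluated on
a tangent vector `v`: it is `δ a ⊗ σ^* b + a ⊗ σ^* (δ b)`, where `σ^* (δ b)` is pulled back as a
one-form. -/
def tensorPullbackConnection {P : Set Y} (δ : LogConnection L P) (σ : Y → Y) (a b : ∀ y, L y)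
    (y : Y) (v : TangentSpace 𝓘(ℂ) y) : L y ⊗[ℂ] L (σ y) :=
  δ.toFun a y v ⊗ₜ[ℂ] b (σ y) + a y ⊗ₜ[ℂ] δ.toFun b (σ y) (mfderiv 𝓘(ℂ) 𝓘(ℂ) σ y v)

/-- An odd structure on `(L, δ)` with respect to an involution `σ` and a divisor `R`: a
skew-symmetric isomorphism `μ : L ⊗ σ^* L ≅ 𝒪(R)` that intertwines `δ ⊗ σ^* δ` and `∂_R`.
The isomorphism of invertible sheaves is given by its fibres `μ y` over `y ∉ R`, which are
scalar-valued since `𝒪(R)` is the sheaf of functions there; the `μ y` with `y ∈ R` carry no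
information. As `L ⊗ σ^* L` is locally generated by sections `a ⊗ σ^* b`, the fields `map_section`
and `map_generator` say that `μ` maps sections of `L ⊗ σ^* L` to sections of `𝒪(R)`, and local
generators to local generators, i.e. that it is an isomorphism, over the points of `R` too. -/
structure OddStructure {P : Set Y} (δ : LogConnection L P) (σ : Y → Y) (R : Set Y) where
  μ : ∀ y, L y ⊗[ℂ] L (σ y) →ₗ[ℂ] ℂ
  map_section : ∀ (U : Set Y) (a b : ∀ y, L y), IsOpen U →
    IsHolSection U a → IsHolSection (σ ⁻¹' U) b →
    IsSectionO R U (fun y => μ y (tensorPullback σ a b y))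
  map_generator : ∀ (U : Set Y) (a b : ∀ y, L y), IsOpen U →
    IsHolSection U a → IsHolSection (σ ⁻¹' U) b →
    (∀ y ∈ U, a y ≠ 0) → (∀ y ∈ σ ⁻¹' U, b y ≠ 0) →
    IsGeneratorO R U (fun y => μ y (tensorPullback σ a b y))
  /-- `σ^* μ = - μ` -/
  skew : ∀ (a b : ∀ y, L y), ∀ y ∉ R,
    μ (σ y) (tensorPullback σ b a (σ y)) = - μ y (tensorPullback σ a b y)
  intertwines : ∀ (U : Set Y) (a b : ∀ y, L y), IsOpen U →
    IsHolSection U a → IsHolSection (σ ⁻¹' U) b →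
    ∀ y ∈ U \ (R ∪ P), ∀ v : TangentSpace 𝓘(ℂ) y,
      canonicalConnectionO (fun y => μ y (tensorPullback σ a b y)) y v
        = μ y (tensorPullbackConnection δ σ a b y v)

end Connections

end OddConn

end

/-! The theorem compares residues in one logarithmic derivative. Near a point `q` choose a
coordinate `z` and a frame `e` of the line bundle, and likewise `z'`, `e'` near `σ q`. The
connection forms are `h dz / z` and `k dz' / z'`, and the residues are the values of `h` and `k` at
the two points (`IsConnectionForm.hasResidueAt`). Put `f = μ (e ⊗ σ^* e')`. Since `μ` intertwines
the connections, `df / f = h dz / z + σ^* (k dz' / z')`. Since `μ` is an isomorphism onto `𝒪(R)`,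
`f` has a simple pole at `q` if `q ∈ R` and is a unit otherwise. The involution is biholomorphic, so
`z' ∘ σ` is again a coordinate at `q` and pulling back preserves the residue. Hence the two residues
add up to the order of `f`, which is `-1` on `R` and `0` off `R` (`add_eq_neg_of_deriv_eq`,
`OddStructure.add_eq_neg`).

A ramification point is fixed by `σ`, so twice its residue is `-1`. Flat sections are multiples of
`z ^ (-c) e ^ (-H)` times the frame, where `c` is the residue and `H` is holomorphic, so the
monodromy is `exp (-2πi c)` (`IsConnectionForm.hasMonodromyAt`), which is `-1` for `c = -1/2`. Over
a point of `D` the fibre is an unramified pair exchanged by `σ`, and the sum is `0`.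

What the cover must supply is that `σ` is a holomorphic involution and that the poles are isolated.
Both come from the local form `z ↦ z ^ n` of `π` and from counting multiplicities in fibres. -/

noncomputable section

namespace OddConn

set_option linter.unusedSectionVars false

/-! ### Charts, the coordinate vector field, and analyticity in charts -/

section Coordinates

variable {Y : Type*} [TopologicalSpace Y] [ChartedSpace ℂ Y]

theorem tendsto_chart_symm (p : Y) :
    Tendsto (chartAt ℂ p).symm (𝓝 (chartAt ℂ p p)) (𝓝 p) := by
  simpa using (chartAt ℂ p).tendsto_symm (mem_chart_source ℂ p)

theorem tendsto_chart_symm_punctured (p : Y) :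
    Tendsto (chartAt ℂ p).symm (𝓝[≠] (chartAt ℂ p p)) (𝓝[≠] p) := by
  refine tendsto_nhdsWithin_iff.2 ⟨(tendsto_chart_symm p).mono_left nhdsWithin_le_nhds, ?_⟩
  filter_upwards [self_mem_nhdsWithin, nhdsWithin_le_nhds ((chartAt ℂ p).open_target.mem_nhds
    ((chartAt ℂ p).map_source (mem_chart_source ℂ p)))] with w hw hw' h
  exact hw (by rw [← (chartAt ℂ p).right_inv hw', h]; rfl)

theorem tendsto_chart_punctured (p : Y) :
    Tendsto (chartAt ℂ p) (𝓝[≠] p) (𝓝[≠] (chartAt ℂ p p)) := by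
  refine tendsto_nhdsWithin_iff.2
    ⟨((chartAt ℂ p).continuousAt (mem_chart_source ℂ p)).mono_left nhdsWithin_le_nhds, ?_⟩
  filter_upwards [self_mem_nhdsWithin, nhdsWithin_le_nhds ((chartAt ℂ p).open_source.mem_nhds
    (mem_chart_source ℂ p))] with w hw hw' h
  exact hw ((chartAt ℂ p).injOn hw' (mem_chart_source ℂ p) h)

theorem eventually_mem_chart_source (p : Y) : ∀ᶠ y in 𝓝 p, y ∈ (chartAt ℂ p).source :=
  (chartAt ℂ p).open_source.mem_nhds (mem_chart_source ℂ p)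

theorem eventually_mem_chart_target (p : Y) :
    ∀ᶠ w in 𝓝 (chartAt ℂ p p), w ∈ (chartAt ℂ p).target :=
  (chartAt ℂ p).open_target.mem_nhds ((chartAt ℂ p).map_source (mem_chart_source ℂ p))

theorem chart_symm_chart_self (p : Y) : (chartAt ℂ p).symm (chartAt ℂ p p) = p :=
  (chartAt ℂ p).left_inv (mem_chart_source ℂ p)

/-- A one-dimensional complex manifold of class `C¹` is of class `C²`. -/
theorem isManifold_two [IsManifold 𝓘(ℂ) 1 Y] : IsManifold 𝓘(ℂ) 2 Y := by
  refine isManifold_of_contDiffOn _ _ _ fun e e' he he' => ?_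
  have h := (contDiffGroupoid 1 𝓘(ℂ)).compatible he he'
  have h1 := (contDiffGroupoid_le (I := 𝓘(ℂ)) le_rfl h)
  have h2 : ContDiffOn ℂ 1 (e.symm ≫ₕ e') (e.symm ≫ₕ e').source := by
    have := (mem_groupoid_of_pregroupoid.1 h1).1
    simpa [contDiffPregroupoid] using! this
  -- Complex differentiability on an open set already gives every order of smoothness.
  simpa using! (h2.differentiableOn one_ne_zero).contDiffOn (n := 2) (e.symm ≫ₕ e').open_source

variable [IsManifold 𝓘(ℂ) 1 Y]

/-- The coordinate vector field of the preferred chart at `p`. -/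
def coordField (p y : Y) : TangentSpace 𝓘(ℂ) y :=
  (trivializationAt ℂ (TangentSpace 𝓘(ℂ)) p).symm y (1 : ℂ)

theorem mdifferentiableAt_chart_symm {p y : Y} (hy : y ∈ (chartAt ℂ p).source) :
    MDifferentiableAt 𝓘(ℂ) 𝓘(ℂ) (chartAt ℂ p).symm (chartAt ℂ p y) :=
  mdifferentiableAt_atlas_symm (chart_mem_atlas ℂ p) ((chartAt ℂ p).map_source hy)

theorem mdifferentiableAt_chart {p y : Y} (hy : y ∈ (chartAt ℂ p).source) :
    MDifferentiableAt 𝓘(ℂ) 𝓘(ℂ) (chartAt ℂ p) y :=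
  mdifferentiableAt_atlas (chart_mem_atlas ℂ p) hy

theorem coordField_eq {p y : Y} (hy : y ∈ (chartAt ℂ p).source) :
    coordField p y = mfderiv 𝓘(ℂ) 𝓘(ℂ) (chartAt ℂ p).symm (chartAt ℂ p y) (1 : ℂ) := by
  have := congrArg (fun A : ℂ →L[ℂ] TangentSpace 𝓘(ℂ) y => A 1)
    (TangentBundle.symmL_trivializationAt (I := 𝓘(ℂ)) hy)
  rw [Bundle.Trivialization.symmL_apply _ (by simpa using hy)] at this
  simpa [coordField, mfderivWithin_univ] using! this

theorem mvfderiv_coordField {p y : Y} (hy : y ∈ (chartAt ℂ p).source) {f : Y → ℂ}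
    (hf : MDifferentiableAt 𝓘(ℂ) 𝓘(ℂ) f y) :
    mvfderiv 𝓘(ℂ) f y (coordField p y) = deriv (f ∘ (chartAt ℂ p).symm) (chartAt ℂ p y) := by
  have h := mfderiv_comp (I := 𝓘(ℂ)) (I' := 𝓘(ℂ)) (I'' := 𝓘(ℂ)) (g := f) (f := (chartAt ℂ p).symm)
    (chartAt ℂ p y) (by rwa [(chartAt ℂ p).left_inv hy]) (mdifferentiableAt_chart_symm hy)
  rw [mfderiv_eq_fderiv] at h
  have h2 := congrArg (fun A : ℂ →L[ℂ] ℂ => A 1) h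
  rw [(chartAt ℂ p).left_inv hy] at h2
  rw [coordField_eq hy, ← fderiv_apply_one_eq_deriv]
  exact h2.symm

theorem mvfderiv_localCoord {p y : Y} (hy : y ∈ (chartAt ℂ p).source) :
    mvfderiv 𝓘(ℂ) (localCoord p) y (coordField p y) = 1 := by
  rw [mvfderiv_coordField hy]
  · have : localCoord p ∘ (chartAt ℂ p).symm =ᶠ[𝓝 (chartAt ℂ p y)] fun w => w - chartAt ℂ p p := by
      filter_upwards [(chartAt ℂ p).open_target.mem_nhds ((chartAt ℂ p).map_source hy)] with w hw
      simp [localCoord, (chartAt ℂ p).right_inv hw]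
    rw [this.deriv_eq]
    simp
  · exact (mdifferentiableAt_chart hy).sub mdifferentiableAt_const

theorem coordField_ne_zero {p y : Y} (hy : y ∈ (chartAt ℂ p).source) : coordField p y ≠ 0 := by
  intro h
  have := mvfderiv_localCoord hy
  rw [h, map_zero] at this
  exact zero_ne_one this

/-- Tangent spaces are lines, so a one-form is determined by its value on the coordinate field. This
reduces every identity of forms below to one of scalar functions. -/
theorem exists_eq_smul_coordField {p y : Y} (hy : y ∈ (chartAt ℂ p).source)
    (v : TangentSpace 𝓘(ℂ) y) : ∃ c : ℂ, v = c • coordField p y := by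
  refine ⟨(show ℂ from v) / (show ℂ from coordField p y), ?_⟩
  exact (div_mul_cancel₀ (show ℂ from v) (coordField_ne_zero hy)).symm

theorem secDiffAt_coordField {p y : Y} (hy : y ∈ (chartAt ℂ p).source) :
    MDifferentiableAt 𝓘(ℂ) (𝓘(ℂ).prod 𝓘(ℂ))
      (fun y => (TotalSpace.mk' ℂ y (coordField p y) : TotalSpace ℂ (TangentSpace 𝓘(ℂ)))) y := by
  -- The tangent bundle is one class less smooth than the manifold, so a bundle of class `C¹` needs
  -- a manifold of class `C²`.
  have : IsManifold 𝓘(ℂ) (1 + 1) Y := by rw [one_add_one_eq_two]; exact isManifold_two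
  have : ContMDiffVectorBundle 1 ℂ (TangentSpace 𝓘(ℂ) : Y → Type) 𝓘(ℂ) :=
    TangentBundle.contMDiffVectorBundle
  rw [Bundle.Trivialization.mdifferentiableAt_section_iff 𝓘(ℂ)
    (trivializationAt ℂ (TangentSpace 𝓘(ℂ)) p) _ (by simpa using hy)]
  refine (mdifferentiableAt_const (c := (1 : ℂ))).congr_of_eventuallyEq ?_
  filter_upwards [(chartAt ℂ p).open_source.mem_nhds hy] with x hx
  rw [coordField, Bundle.Trivialization.apply_mk_symm _ (by simpa using hx)]

/-- A map that is holomorphic near `p` is analytic in charts. -/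
theorem analyticAt_chart {X : Type*} [TopologicalSpace X] [ChartedSpace ℂ X]
    [IsManifold 𝓘(ℂ) 1 X] {f : Y → X} {p : Y}
    (hf : ∀ᶠ y in 𝓝 p, MDifferentiableAt 𝓘(ℂ) 𝓘(ℂ) f y) :
    AnalyticAt ℂ (fun w => chartAt ℂ (f p) (f ((chartAt ℂ p).symm w))) (chartAt ℂ p p) := by
  have hc := tendsto_chart_symm p
  have hs : ∀ᶠ y in 𝓝 p, f y ∈ (chartAt ℂ (f p)).source :=
    hf.self_of_nhds.continuousAt.eventually
      ((chartAt ℂ (f p)).open_source.mem_nhds (mem_chart_source ℂ _))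
  have key : ∀ᶠ w in 𝓝 (chartAt ℂ p p), DifferentiableAt ℂ
      (fun w => chartAt ℂ (f p) (f ((chartAt ℂ p).symm w))) w := by
    filter_upwards [hc.eventually hf, hc.eventually hs, eventually_mem_chart_target p] with w h1 h2 h3
    have h4 : MDifferentiableAt 𝓘(ℂ) 𝓘(ℂ) (chartAt ℂ p).symm w :=
      mdifferentiableAt_atlas_symm (chart_mem_atlas ℂ p) h3
    exact ((mdifferentiableAt_chart h2).comp w (h1.comp w h4)).differentiableAt
  exact Complex.analyticAt_iff_eventually_differentiableAt.2 key

/-- A function that is holomorphic near `p` is analytic in charts. -/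
theorem analyticAt_comp_chart_symm {f : Y → ℂ} {p : Y}
    (hf : ∀ᶠ y in 𝓝 p, MDifferentiableAt 𝓘(ℂ) 𝓘(ℂ) f y) :
    AnalyticAt ℂ (f ∘ (chartAt ℂ p).symm) (chartAt ℂ p p) := by
  have := analyticAt_chart (X := ℂ) hf
  simp only [chartAt_self_eq] at this
  exact this

end Coordinates

/-! ### Local frames, connection forms and residues -/

section ConnectionForm

variable {Y : Type*} [TopologicalSpace Y] [ChartedSpace ℂ Y] [IsManifold 𝓘(ℂ) 1 Y]
  {L : Y → Type*} [TopologicalSpace (TotalSpace ℂ L)]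
  [∀ y, AddCommGroup (L y)] [∀ y, Module ℂ (L y)] [∀ y, TopologicalSpace (L y)]
  [∀ y, IsTopologicalAddGroup (L y)] [∀ y, ContinuousSMul ℂ (L y)]
  [FiberBundle ℂ L] [VectorBundle ℂ ℂ L]

variable (L) in
/-- The local frame of the line bundle `L` given by its preferred trivialization at `p`. -/
def frame (p y : Y) : L y := (trivializationAt ℂ L p).symm y (1 : ℂ)

/-- The coefficient of `v` with respect to the local frame at `p`. -/
def coeff (p : Y) {y : Y} (v : L y) : ℂ := (trivializationAt ℂ L p (TotalSpace.mk' ℂ y v)).2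

variable (L) in
theorem eventually_mem_baseSet (p : Y) : ∀ᶠ y in 𝓝 p, y ∈ (trivializationAt ℂ L p).baseSet :=
  (trivializationAt ℂ L p).open_baseSet.mem_nhds (FiberBundle.mem_baseSet_trivializationAt' p)

theorem coeff_frame {p y : Y} (hy : y ∈ (trivializationAt ℂ L p).baseSet) :
    coeff p (frame L p y) = 1 := by
  rw [coeff, frame, Bundle.Trivialization.apply_mk_symm _ hy]

theorem coeff_smul {p y : Y} (hy : y ∈ (trivializationAt ℂ L p).baseSet) (c : ℂ) (v : L y) :
    coeff p (c • v) = c * coeff p v :=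
  ((trivializationAt ℂ L p).linear ℂ hy).map_smul c v

theorem coeff_smul_frame {p y : Y} (hy : y ∈ (trivializationAt ℂ L p).baseSet) (c : ℂ) :
    coeff p (c • frame L p y) = c := by
  rw [coeff_smul hy, coeff_frame hy, mul_one]

theorem coeff_zero {p y : Y} (hy : y ∈ (trivializationAt ℂ L p).baseSet) :
    coeff p (0 : L y) = 0 := by
  simpa using coeff_smul hy 0 (0 : L y)

theorem frame_ne_zero {p y : Y} (hy : y ∈ (trivializationAt ℂ L p).baseSet) :
    frame L p y ≠ 0 := by
  intro h
  have := coeff_frame hy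
  rw [h, coeff_zero hy] at this
  exact zero_ne_one this

theorem coeff_smul_frame_eq {p y : Y} (hy : y ∈ (trivializationAt ℂ L p).baseSet) (v : L y) :
    coeff p v • frame L p y = v := by
  have h := (trivializationAt ℂ L p).symm_apply_apply_mk hy v
  have h2 := ((trivializationAt ℂ L p).symmL ℂ y).map_smul (coeff p v) (1 : ℂ)
  rw [Bundle.Trivialization.symmL_apply _ hy, Bundle.Trivialization.symmL_apply _ hy] at h2
  rw [frame, ← h2]
  simpa [coeff] using h

variable [ContMDiffVectorBundle 1 ℂ L 𝓘(ℂ)]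

theorem secDiffAt_iff_coeff {p y : Y} (hy : y ∈ (trivializationAt ℂ L p).baseSet)
    (s : ∀ y, L y) :
    SecDiffAt s y ↔ MDifferentiableAt 𝓘(ℂ) 𝓘(ℂ) (fun y => coeff p (s y)) y :=
  Bundle.Trivialization.mdifferentiableAt_section_iff 𝓘(ℂ) _ s hy

theorem secDiffAt_frame {p y : Y} (hy : y ∈ (trivializationAt ℂ L p).baseSet) :
    SecDiffAt (frame L p) y := by
  rw [secDiffAt_iff_coeff hy]
  refine (mdifferentiableAt_const (c := (1 : ℂ))).congr_of_eventuallyEq ?_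
  filter_upwards [(trivializationAt ℂ L p).open_baseSet.mem_nhds hy] with x hx
  exact coeff_frame hx

theorem secDiffAt_apply_coordField {η : ∀ y : Y, TangentSpace 𝓘(ℂ) y →L[ℂ] L y} {p y : Y}
    (hy : y ∈ (chartAt ℂ p).source) (hη : FormDiffAt η y) :
    SecDiffAt (fun y => η y (coordField p y)) y :=
  MDifferentiableAt.clm_bundle_apply hη (secDiffAt_coordField hy)

/-- A holomorphic `L`-valued one-form is, near `p`, of the form `h dz ⊗ frame`. -/
theorem exists_analyticAt_form {η : ∀ y : Y, TangentSpace 𝓘(ℂ) y →L[ℂ] L y} {p : Y}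
    (hη : ∀ᶠ y in 𝓝 p, FormDiffAt η y) :
    ∃ h : ℂ → ℂ, AnalyticAt ℂ h (chartAt ℂ p p) ∧
      ∀ᶠ y in 𝓝 p, η y (coordField p y) = h (chartAt ℂ p y) • frame L p y := by
  refine ⟨(fun y => coeff p (η y (coordField p y))) ∘ (chartAt ℂ p).symm,
    analyticAt_comp_chart_symm ?_, ?_⟩
  · filter_upwards [hη, eventually_mem_chart_source p, eventually_mem_baseSet L p] with y h1 h2 h3
    exact (secDiffAt_iff_coeff h3 _).1 (secDiffAt_apply_coordField h2 h1)
  · filter_upwards [eventually_mem_chart_source p, eventually_mem_baseSet L p] with y h2 h3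
    simp only [Function.comp_apply]
    rw [(chartAt ℂ p).left_inv h2, coeff_smul_frame_eq h3]

/-- `z⁻¹ h dz` is the connection form of `δ` near `p`, with respect to the local frame and the local
coordinate at `p`. -/
def IsConnectionForm {P : Set Y} (δ : LogConnection L P) (p : Y) (h : ℂ → ℂ) : Prop :=
  AnalyticAt ℂ h (chartAt ℂ p p) ∧ ∀ᶠ y in 𝓝[≠] p,
    localCoord p y • δ.toFun (frame L p) y (coordField p y) = h (chartAt ℂ p y) • frame L p y

theorem exists_isConnectionForm {P : Set Y} (δ : LogConnection L P) {p : Y} (hp : p ∈ P) :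
    ∃ h, IsConnectionForm δ p h := by
  obtain ⟨η, hη, hη'⟩ := (δ.log_pole (trivializationAt ℂ L p).baseSet (frame L p)
    (trivializationAt ℂ L p).open_baseSet (fun y hy => secDiffAt_frame hy)).2 p
    ⟨FiberBundle.mem_baseSet_trivializationAt' p, hp⟩
  obtain ⟨h, ha, hh⟩ := exists_analyticAt_form hη
  refine ⟨h, ha, ?_⟩
  filter_upwards [hη', nhdsWithin_le_nhds hh] with y h1 h2
  rw [← h2, h1]
  rfl

/-- The connection evaluated on a multiple of the local frame. -/
theorem LogConnection.toFun_smul_frame {P : Set Y} (δ : LogConnection L P) {p : Y} {U : Set Y}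
    (hU : IsOpen U) (hUL : U ⊆ (trivializationAt ℂ L p).baseSet) (hUC : U ⊆ (chartAt ℂ p).source)
    {f : Y → ℂ} (hf : ∀ y ∈ U, MDifferentiableAt 𝓘(ℂ) 𝓘(ℂ) f y) {s : ∀ y, L y}
    (hs : ∀ y ∈ U, s y = f y • frame L p y) {y : Y} (hy : y ∈ U \ P) :
    δ.toFun s y (coordField p y) = f y • δ.toFun (frame L p) y (coordField p y) +
      deriv (f ∘ (chartAt ℂ p).symm) (chartAt ℂ p y) • frame L p y := by
  have hhol : IsHolSection U fun y => f y • frame L p y := fun y hy =>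
    (hf y hy).smul_section (secDiffAt_frame (hUL hy))
  rw [← δ.congr U _ s hU hhol (fun y hy => (hs y hy).symm) y hy,
    δ.leibniz U f _ hU hf (fun y hy => secDiffAt_frame (hUL hy)) y hy,
    mvfderiv_coordField (hUC hy.1) (hf y hy.1)]

/-- The residue is the value of the connection form `z⁻¹ h dz` at the pole. -/
theorem IsConnectionForm.hasResidueAt {P : Set Y} {δ : LogConnection L P} {p : Y} {h : ℂ → ℂ}
    (hδ : IsConnectionForm δ p h) (hp : p ∈ P) (hP : ∀ᶠ y in 𝓝[≠] p, y ∉ P) :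
    HasResidueAt δ p (h (chartAt ℂ p p)) := by
  intro s hs
  obtain ⟨U, hU, hUo, hpU⟩ := eventually_nhds_iff.1
    (hs.and ((eventually_mem_chart_source p).and (eventually_mem_baseSet L p)))
  obtain ⟨η, hη, hη'⟩ := (δ.log_pole U s hUo (fun y hy => (hU y hy).1)).2 p ⟨hpU, hp⟩
  obtain ⟨k, hk, hk'⟩ := exists_analyticAt_form hη
  refine ⟨η, ⟨hη, hη'⟩, ?_⟩
  set f : Y → ℂ := fun y => coeff p (s y)
  have hf : ∀ y ∈ U, MDifferentiableAt 𝓘(ℂ) 𝓘(ℂ) f y := fun y hy =>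
    (secDiffAt_iff_coeff (hU y hy).2.2 s).1 (hU y hy).1
  have hfs : ∀ y ∈ U, s y = f y • frame L p y := fun y hy =>
    (coeff_smul_frame_eq (hU y hy).2.2 (s y)).symm
  have hF := analyticAt_comp_chart_symm (p := p) (f := f)
    (Filter.Eventually.mono (hUo.mem_nhds hpU) hf)
  set F := f ∘ (chartAt ℂ p).symm with hFdef
  set z := chartAt ℂ p p
  -- For `s = f e` the Leibniz rule gives `z δ s = (f h + z f') dz ⊗ e`; here `k` is the coefficient
  -- of the holomorphic extension of `z δ s`.
  have key : ∀ᶠ y in 𝓝[≠] p, k (chartAt ℂ p y) = F (chartAt ℂ p y) * h (chartAt ℂ p y) +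
      (chartAt ℂ p y - z) * deriv F (chartAt ℂ p y) := by
    filter_upwards [hη', nhdsWithin_le_nhds hk', hδ.2, hP, nhdsWithin_le_nhds (hUo.mem_nhds hpU)]
      with y h1 h2 h3 h4 h5
    have hb := (hU y h5).2.2
    have h6 := δ.toFun_smul_frame hUo (fun y hy => (hU y hy).2.2) (fun y hy => (hU y hy).2.1) hf
      hfs ⟨h5, h4⟩
    rw [h1, smul_apply, h6, smul_add, smul_comm, h3, smul_smul, smul_smul,
      ← add_smul] at h2
    have h7 := congrArg (coeff p) h2
    rw [coeff_smul_frame hb, coeff_smul_frame hb] at h7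
    rw [← h7, hFdef, Function.comp_apply, (chartAt ℂ p).left_inv (hU y h5).2.1]
    rfl
  have key' : ∀ᶠ w in 𝓝[≠] z, k w = F w * h w + (w - z) * deriv F w := by
    filter_upwards [(tendsto_chart_symm_punctured p).eventually key,
      nhdsWithin_le_nhds (eventually_mem_chart_target p)] with w h1 h2
    rwa [(chartAt ℂ p).right_inv h2] at h1
  -- At the pole itself `δ` carries no information, so the value of `k` there is found as a limit;
  -- the term `z f'` disappears in it.
  have hval : k z = F z * h z := by
    have hR : ContinuousAt (fun w => F w * h w + (w - z) * deriv F w) z :=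
      (hF.continuousAt.mul hδ.1.continuousAt).add
        ((continuousAt_id.sub continuousAt_const).mul hF.deriv.continuousAt)
    have h1 := hR.tendsto.mono_left (nhdsWithin_le_nhds (s := {z}ᶜ))
    have h2 := tendsto_nhds_unique (hk.continuousAt.tendsto.mono_left nhdsWithin_le_nhds)
      (h1.congr' (key'.mono fun w hw => hw.symm))
    simpa using h2
  intro v
  obtain ⟨c, rfl⟩ := exists_eq_smul_coordField (mem_chart_source ℂ p) v
  rw [map_smul, map_smul, mvfderiv_localCoord (mem_chart_source ℂ p), hk'.self_of_nhds, hval,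
    hfs p hpU, hFdef, Function.comp_apply, chart_symm_chart_self, smul_eq_mul, mul_one, smul_smul,
    smul_smul, smul_smul]
  congr 1
  ring

end ConnectionForm

/-! ### The scalar equation of flat sections and its explicit solutions -/

section LinearODE

/-- The quotient of two solutions of `f' = a f` is locally constant. -/
theorem eventually_div_eq_of_hasDerivAt {f g a : ℂ → ℂ} {u₀ : ℂ}
    (hf : ∀ᶠ u in 𝓝 u₀, HasDerivAt f (a u * f u) u)
    (hg : ∀ᶠ u in 𝓝 u₀, HasDerivAt g (a u * g u) u) (hg0 : ∀ u, g u ≠ 0) :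
    ∀ᶠ u in 𝓝 u₀, f u / g u = f u₀ / g u₀ := by
  obtain ⟨ε, hε, hball⟩ := Metric.eventually_nhds_iff_ball.1 (hf.and hg)
  have hd : ∀ u ∈ Metric.ball u₀ ε, HasDerivAt (fun u => f u / g u) 0 u := by
    intro u hu
    refine ((hball u hu).1.div (hball u hu).2 (hg0 u)).congr_deriv ?_
    rw [div_eq_zero_iff]
    left
    ring
  filter_upwards [Metric.ball_mem_nhds u₀ hε] with u hu
  exact Metric.isOpen_ball.is_const_of_deriv_eq_zero (convex_ball u₀ ε).isPreconnected
    (fun u hu => (hd u hu).differentiableAt.differentiableWithinAt)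
    (fun u hu => (hd u hu).deriv) hu (Metric.mem_ball_self hε)

/-- A branch of `e ^ a (u - z₀) ^ (-c)`, multiplied by `e ^ (-H)`. -/
def powExp (z₀ c a ζ : ℂ) (H : ℂ → ℂ) (u : ℂ) : ℂ :=
  Complex.exp (-c * (a + Complex.log ((u - z₀) / ζ)) - H u)

theorem hasDerivAt_powExp {z₀ c a ζ : ℂ} {H : ℂ → ℂ} {u k : ℂ} (hζ : ζ ≠ 0)
    (hu : (u - z₀) / ζ ∈ Complex.slitPlane) (hH : HasDerivAt H k u) :
    HasDerivAt (powExp z₀ c a ζ H) (-(c / (u - z₀) + k) * powExp z₀ c a ζ H u) u := by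
  have hu0 : u - z₀ ≠ 0 := by
    intro h
    rw [h, zero_div] at hu
    exact Complex.zero_notMem_slitPlane hu
  have h1 : HasDerivAt (fun u => (u - z₀) / ζ) (1 / ζ) u :=
    ((hasDerivAt_id u).sub_const z₀).div_const ζ
  have h2 := (((h1.clog hu).const_add a).const_mul (-c)).sub hH
  refine h2.cexp.congr_deriv ?_
  simp only [powExp, Pi.sub_apply]
  field_simp
  ring

/-- The bound `1 / 2` on the parameter keeps the difference of angles in `(-π, π)`, where the
principal logarithm inverts the exponential. -/
theorem log_div_exp_two_pi_I {w : ℂ} (hw : w ≠ 0) {t t₀ : ℝ} (ht : |t - t₀| < 1 / 2) :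
    Complex.log (w * Complex.exp (2 * Real.pi * Complex.I * t) /
      (w * Complex.exp (2 * Real.pi * Complex.I * t₀))) =
      2 * Real.pi * Complex.I * t - 2 * Real.pi * Complex.I * t₀ := by
  rw [mul_div_mul_left _ _ hw, ← Complex.exp_sub]
  have him : (2 * Real.pi * Complex.I * t - 2 * Real.pi * Complex.I * t₀ : ℂ).im =
      2 * Real.pi * (t - t₀) := by
    simp [mul_sub]
  rw [abs_lt] at ht
  apply Complex.log_exp <;> rw [him] <;> nlinarith [Real.pi_pos]

end LinearODE

/-! ### Flat sections near a pole and the monodromy -/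

section Monodromy

variable {Y : Type*} [TopologicalSpace Y] [ChartedSpace ℂ Y] [IsManifold 𝓘(ℂ) 1 Y]
  {L : Y → Type*} [TopologicalSpace (TotalSpace ℂ L)]
  [∀ y, AddCommGroup (L y)] [∀ y, Module ℂ (L y)] [∀ y, TopologicalSpace (L y)]
  [∀ y, IsTopologicalAddGroup (L y)] [∀ y, ContinuousSMul ℂ (L y)]
  [FiberBundle ℂ L] [VectorBundle ℂ ℂ L]

/-- The disc of radius `ε` around `p`, in the preferred chart at `p`, is contained in the domains of
the chart and of the local frame at `p`, contains no pole except for `p`, and `z⁻¹ h dz` is the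
connection form of `δ` on it. -/
structure IsConnectionFormOnDisc {P : Set Y} (δ : LogConnection L P) (p : Y) (h : ℂ → ℂ)
    (ε : ℝ) : Prop where
  target : ∀ u ∈ Metric.ball (chartAt ℂ p p) ε, u ∈ (chartAt ℂ p).target
  baseSet : ∀ u ∈ Metric.ball (chartAt ℂ p p) ε,
    (chartAt ℂ p).symm u ∈ (trivializationAt ℂ L p).baseSet
  differentiableOn : DifferentiableOn ℂ h (Metric.ball (chartAt ℂ p p) ε)
  notMem : ∀ u ∈ Metric.ball (chartAt ℂ p p) ε, u ≠ chartAt ℂ p p → (chartAt ℂ p).symm u ∉ P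
  form : ∀ u ∈ Metric.ball (chartAt ℂ p p) ε, u ≠ chartAt ℂ p p →
    δ.toFun (frame L p) ((chartAt ℂ p).symm u) (coordField p ((chartAt ℂ p).symm u)) =
      (h u / (u - chartAt ℂ p p)) • frame L p ((chartAt ℂ p).symm u)

/-- Parallel transport runs around whole circles, so the germ conditions at `p` have to hold on one
common disc. -/
theorem IsConnectionForm.exists_disc {P : Set Y} {δ : LogConnection L P} {p : Y} {h : ℂ → ℂ}
    (hδ : IsConnectionForm δ p h) (hP : ∀ᶠ y in 𝓝[≠] p, y ∉ P) :
    ∃ ε > 0, IsConnectionFormOnDisc δ p h ε := by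
  have h1 := (tendsto_chart_symm p).eventually (eventually_mem_baseSet L p)
  have h2 := (tendsto_chart_symm_punctured p).eventually (hP.and hδ.2)
  have h3 := Complex.analyticAt_iff_eventually_differentiableAt.1 hδ.1
  rw [eventually_nhdsWithin_iff] at h2
  obtain ⟨ε, hε, hball⟩ := Metric.eventually_nhds_iff_ball.1
    ((eventually_mem_chart_target p).and (h1.and (h2.and h3)))
  refine ⟨ε, hε, fun u hu => (hball u hu).1, fun u hu => (hball u hu).2.1,
    fun u hu => (hball u hu).2.2.2.differentiableWithinAt,
    fun u hu hu' => ((hball u hu).2.2.1 hu').1, fun u hu hu' => ?_⟩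
  have h4 := ((hball u hu).2.2.1 hu').2
  have h5 : u - chartAt ℂ p p ≠ 0 := sub_ne_zero.2 hu'
  rw [localCoord, (chartAt ℂ p).right_inv (hball u hu).1] at h4
  rw [div_eq_inv_mul, mul_smul, ← h4, inv_smul_smul₀ h5]

variable [ContMDiffVectorBundle 1 ℂ L 𝓘(ℂ)] {P : Set Y} {δ : LogConnection L P} {p : Y} {h : ℂ → ℂ}
  {ε : ℝ}

/-- With `z` the centre, the coefficient of `δ (g e)` is `g' + g h / (u - z)`, which the
differential equation makes vanish. -/
theorem IsConnectionFormOnDisc.isFlatOn (hδ : IsConnectionFormOnDisc δ p h ε) {W : Set ℂ}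
    (hW : IsOpen W) (hWε : W ⊆ Metric.ball (chartAt ℂ p p) ε) (hWp : chartAt ℂ p p ∉ W)
    {g : ℂ → ℂ}
    (hg : ∀ u ∈ W, HasDerivAt g (-(h u / (u - chartAt ℂ p p)) * g u) u) :
    IsFlatOn δ ((chartAt ℂ p).source ∩ chartAt ℂ p ⁻¹' W)
      (fun y => g (chartAt ℂ p y) • frame L p y) := by
  set V := (chartAt ℂ p).source ∩ chartAt ℂ p ⁻¹' W
  have hVo : IsOpen V := (chartAt ℂ p).isOpen_inter_preimage hW
  have hVb : V ⊆ (trivializationAt ℂ L p).baseSet := fun y hy => by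
    have := hδ.baseSet _ (hWε hy.2)
    rwa [(chartAt ℂ p).left_inv hy.1] at this
  have hVP : ∀ y ∈ V, y ∉ P := fun y hy => by
    have := hδ.notMem _ (hWε hy.2) (fun h => hWp (h ▸ hy.2))
    rwa [(chartAt ℂ p).left_inv hy.1] at this
  have hf : ∀ y ∈ V, MDifferentiableAt 𝓘(ℂ) 𝓘(ℂ) (g ∘ chartAt ℂ p) y := fun y hy =>
    (hg _ hy.2).differentiableAt.mdifferentiableAt.comp y (mdifferentiableAt_chart hy.1)
  refine ⟨hVo, Set.disjoint_left.2 hVP, fun y hy => (hf y hy).smul_section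
    (secDiffAt_frame (hVb hy)), fun y hy => ?_⟩
  refine ContinuousLinearMap.ext fun v => ?_
  obtain ⟨c, rfl⟩ := exists_eq_smul_coordField hy.1 v
  have h1 := δ.toFun_smul_frame hVo hVb (fun y hy => hy.1) hf
    (s := fun y => g (chartAt ℂ p y) • frame L p y) (fun y hy => rfl) ⟨hy, hVP y hy⟩
  have h2 := hδ.form _ (hWε hy.2) (fun h => hWp (h ▸ hy.2))
  rw [(chartAt ℂ p).left_inv hy.1] at h2
  have h3 : (g ∘ chartAt ℂ p) ∘ (chartAt ℂ p).symm =ᶠ[𝓝 (chartAt ℂ p y)] g := by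
    filter_upwards [(chartAt ℂ p).open_target.mem_nhds ((chartAt ℂ p).map_source hy.1)] with u hu
    simp [(chartAt ℂ p).right_inv hu]
  rw [h3.deriv_eq, (hg _ hy.2).deriv, h2, smul_smul, ← add_smul] at h1
  rw [map_smul, h1, Function.comp_apply]
  have : g (chartAt ℂ p y) * (h (chartAt ℂ p y) / (chartAt ℂ p y - chartAt ℂ p p)) +
      -(h (chartAt ℂ p y) / (chartAt ℂ p y - chartAt ℂ p p)) * g (chartAt ℂ p y) = 0 := by ring
  rw [this, zero_smul, smul_zero]
  rfl

/-- The converse of `IsConnectionFormOnDisc.isFlatOn`: it gives uniqueness of parallel transport,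
while that lemma gives existence. -/
theorem IsConnectionFormOnDisc.hasDerivAt_coeff (hδ : IsConnectionFormOnDisc δ p h ε) {V : Set Y}
    {s : ∀ y, L y} (hs : IsFlatOn δ V s) {u₀ : ℂ} (hu₀ : u₀ ∈ Metric.ball (chartAt ℂ p p) ε)
    (hu₀p : u₀ ≠ chartAt ℂ p p) (hu₀V : (chartAt ℂ p).symm u₀ ∈ V) :
    ∀ᶠ u in 𝓝 u₀, HasDerivAt (fun u => coeff p (s ((chartAt ℂ p).symm u)))
      (-(h u / (u - chartAt ℂ p p)) * coeff p (s ((chartAt ℂ p).symm u))) u := by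
  obtain ⟨hVo, hVP, hVs, hV0⟩ := hs
  set U := V ∩ (trivializationAt ℂ L p).baseSet ∩ (chartAt ℂ p).source
  have hUo : IsOpen U :=
    (hVo.inter (trivializationAt ℂ L p).open_baseSet).inter (chartAt ℂ p).open_source
  have hcont : ContinuousAt (chartAt ℂ p).symm u₀ :=
    (chartAt ℂ p).continuousAt_symm (hδ.target u₀ hu₀)
  filter_upwards [Metric.isOpen_ball.mem_nhds hu₀, isOpen_ne.mem_nhds hu₀p,
    hcont.eventually (hVo.mem_nhds hu₀V)] with u hu hup huV
  have hut := hδ.target u hu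
  have hy : (chartAt ℂ p).symm u ∈ U :=
    ⟨⟨huV, hδ.baseSet u hu⟩, (chartAt ℂ p).map_target hut⟩
  have hf : ∀ y ∈ U, MDifferentiableAt 𝓘(ℂ) 𝓘(ℂ) (fun y => coeff p (s y)) y := fun y hy =>
    (secDiffAt_iff_coeff hy.1.2 s).1 (hVs y hy.1.1)
  have h1 := δ.toFun_smul_frame hUo (fun y hy => hy.1.2) (fun y hy => hy.2) hf
    (fun y hy => (coeff_smul_frame_eq hy.1.2 (s y)).symm) ⟨hy, hδ.notMem u hu hup⟩
  rw [hV0 _ huV, hδ.form u hu hup, (chartAt ℂ p).right_inv hut, smul_smul, ← add_smul] at h1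
  have h2 := congrArg (coeff p) h1
  rw [coeff_smul_frame hy.1.2] at h2
  have h3 := (coeff_zero hy.1.2).symm.trans h2
  have h4 : DifferentiableAt ℂ ((fun y => coeff p (s y)) ∘ (chartAt ℂ p).symm) u :=
    ((hf _ hy).comp u
      (mdifferentiableAt_atlas_symm (chart_mem_atlas ℂ p) hut)).differentiableAt
  refine h4.hasDerivAt.congr_deriv ?_
  linear_combination -h3

theorem smallLoop_zero_eq_one (p : Y) (w : ℂ) : smallLoop p w 1 = smallLoop p w 0 := by
  simp [smallLoop, Complex.exp_two_pi_mul_I]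

/-- The monodromy around a pole, in terms of the connection form `z⁻¹ h dz`. -/
theorem IsConnectionForm.hasMonodromyAt (hδ : IsConnectionForm δ p h)
    (hP : ∀ᶠ y in 𝓝[≠] p, y ∉ P) :
    HasMonodromyAt δ p (Complex.exp (-(2 * Real.pi * Complex.I * h (chartAt ℂ p p)))) := by
  obtain ⟨ε, hε, hd⟩ := hδ.exists_disc hP
  set z := chartAt ℂ p p with hz
  set c := h z
  -- `H` is a primitive of `(h u - c) / (u - z)`, which extends holomorphically over `z` as `dslope
  -- h z`. The connection form is thus split into `c / (u - z)` and an exact part.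
  obtain ⟨H, hH⟩ : Complex.IsExactOn (dslope h z) (Metric.ball z ε) :=
    ((Complex.differentiableOn_dslope (Metric.ball_mem_nhds z hε)).2
      hd.differentiableOn).isExactOn_ball
  have hball : ∀ᶠ w in 𝓝[≠] (0 : ℂ), w ≠ 0 ∧ ‖w‖ < ε := by
    filter_upwards [self_mem_nhdsWithin, nhdsWithin_le_nhds (Metric.ball_mem_nhds 0 hε)] with w h1 h2
    exact ⟨h1, by simpa using h2⟩
  refine hball.mono fun w ⟨hw, hwε⟩ => ?_
  set ζ : ℝ → ℂ := fun t => w * Complex.exp (2 * Real.pi * Complex.I * t) with hζ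
  have hζ0 : ∀ t, ζ t ≠ 0 := fun t => mul_ne_zero hw (Complex.exp_ne_zero _)
  have hζball : ∀ t, z + ζ t ∈ Metric.ball z ε := fun t => by
    have : ‖Complex.exp (2 * Real.pi * Complex.I * t)‖ = 1 := by
      rw [Complex.norm_exp]
      simp
    simpa [hζ, this] using hwε
  have hζz : ∀ t, z + ζ t ≠ z := fun t => by simpa using hζ0 t
  have hζc : Continuous fun t => z + ζ t := by fun_prop
  -- `G` is the solution continued along the loop, with the logarithm replaced by the angle; `g t₀`
  -- is a single-valued branch on a slit disc that agrees with `G` near `t₀`.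
  set G : ℝ → ℂ := fun t => Complex.exp (-c * (2 * Real.pi * Complex.I * t) - H (z + ζ t)) with hG
  set g : ℝ → ℂ → ℂ := fun t₀ => powExp z c (2 * Real.pi * Complex.I * t₀) (ζ t₀) H with hg
  have hgG : ∀ t₀ : ℝ, ∀ᶠ t in 𝓝[Icc 0 1] t₀, g t₀ (z + ζ t) = G t := fun t₀ => by
    filter_upwards [nhdsWithin_le_nhds (Metric.ball_mem_nhds t₀ (half_pos one_pos))] with t ht
    rw [Metric.mem_ball, Real.dist_eq] at ht
    simp only [hg, hG, hζ, powExp]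
    rw [add_sub_cancel_left, log_div_exp_two_pi_I hw ht, add_sub_cancel]
  set W : ℝ → Set ℂ := fun t₀ => Metric.ball z ε ∩ {u | (u - z) / ζ t₀ ∈ Complex.slitPlane} with hW
  have hWo : ∀ t₀, IsOpen (W t₀) := fun t₀ =>
    Metric.isOpen_ball.inter (Complex.isOpen_slitPlane.preimage (by fun_prop))
  have hWz : ∀ t₀, z ∉ W t₀ := fun t₀ ht => by
    have := ht.2
    simp [Complex.zero_notMem_slitPlane] at this
  have hWζ : ∀ t₀, z + ζ t₀ ∈ W t₀ := fun t₀ =>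
    ⟨hζball t₀, by simp [div_self (hζ0 t₀)]⟩
  have hgd : ∀ t₀, ∀ u ∈ W t₀, HasDerivAt (g t₀) (-(h u / (u - z)) * g t₀ u) u := by
    intro t₀ u hu
    refine (hasDerivAt_powExp (hζ0 t₀) hu.2 (hH u hu.1)).congr_deriv ?_
    have huz : u ≠ z := fun h => hWz t₀ (h ▸ hu)
    rw [dslope_of_ne _ huz, slope_def_field, ← add_div, add_sub_cancel]
  have hflat := fun t₀ => hd.isFlatOn (hWo t₀) (fun u hu => hu.1) (hWz t₀) (hgd t₀)
  have hmem : ∀ t, smallLoop p w t ∈ (chartAt ℂ p).source := fun t =>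
    (chartAt ℂ p).map_target (hd.target _ (hζball t))
  have hchart : ∀ t, chartAt ℂ p (smallLoop p w t) = z + ζ t := fun t =>
    (chartAt ℂ p).right_inv (hd.target _ (hζball t))
  have hbase : ∀ t, smallLoop p w t ∈ (trivializationAt ℂ L p).baseSet := fun t =>
    hd.baseSet _ (hζball t)
  -- The loop closes up, so `H` takes the same value at both ends and only the angle contributes.
  have hG1 : G 1 = Complex.exp (-(2 * Real.pi * Complex.I * c)) * G 0 := by
    simp only [hG, hζ, ← Complex.exp_add]
    congr 1
    simp [Complex.exp_two_pi_mul_I]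
    ring
  constructor
  · intro v
    refine ⟨fun t => (coeff p v / G 0 * G t) • frame L p (smallLoop p w t), fun t₀ ht₀ => ?_, ?_⟩
    · refine ⟨_, _, ?_, hd.isFlatOn (hWo t₀) (fun u hu => hu.1) (hWz t₀)
        (g := fun u => coeff p v / G 0 * g t₀ u) (fun u hu => ?_), ?_⟩
      · refine ⟨hmem t₀, ?_⟩
        rw [Set.mem_preimage, hchart]
        exact hWζ t₀
      · refine ((hgd t₀ u hu).const_mul _).congr_deriv ?_
        ring
      · filter_upwards [hgG t₀] with t ht
        rw [hchart, ht]
    · simp only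
      rw [div_mul_cancel₀ _ (Complex.exp_ne_zero _), coeff_smul_frame_eq (hbase 0)]
  · intro S hS
    -- Near each parameter a parallel `S` and `G` solve the same equation, so their quotient `K` is
    -- locally constant, hence constant on the interval.
    set K : ℝ → ℂ := fun t => coeff p (S t) / G t
    have hK : ∀ t₀ ∈ Icc (0 : ℝ) 1, ∀ᶠ t in 𝓝[Icc 0 1] t₀, K t = K t₀ := by
      intro t₀ ht₀
      obtain ⟨V, s, hV, hs, hSs⟩ := hS t₀ ht₀
      have h1 := eventually_div_eq_of_hasDerivAt
        (hd.hasDerivAt_coeff hs (hζball t₀) (hζz t₀) hV)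
        (Filter.Eventually.mono ((hWo t₀).mem_nhds (hWζ t₀)) (hgd t₀))
        (fun u => Complex.exp_ne_zero _)
      have h2 := ((hζc.tendsto t₀).mono_left (nhdsWithin_le_nhds (s := Icc 0 1))).eventually h1
      have h3 : ∀ᶠ t in 𝓝[Icc 0 1] t₀, K t = coeff p (s ((chartAt ℂ p).symm (z + ζ t₀))) /
          g t₀ (z + ζ t₀) := by
        filter_upwards [h2, hSs, hgG t₀] with t ht1 ht2 ht3
        rw [← ht1, ht3]
        simp only [K]
        rw [ht2]
        rfl
      filter_upwards [h3] with t ht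
      rw [ht, h3.self_of_nhdsWithin ht₀]
    have hK' : ∀ t₀ ∈ Icc (0 : ℝ) 1, HasDerivWithinAt K 0 (Icc 0 1) t₀ := fun t₀ ht₀ =>
      (hasDerivWithinAt_const t₀ (Icc 0 1) (K t₀)).congr_of_eventuallyEq (hK t₀ ht₀) rfl
    have hK1 : K 1 = K 0 := constant_of_derivWithin_zero
      (fun t ht => (hK' t ht).differentiableWithinAt)
      (fun t ht => (hK' t (Ico_subset_Icc_self ht)).derivWithin
        (uniqueDiffOn_Icc_zero_one t (Ico_subset_Icc_self ht))) 1 (right_mem_Icc.2 zero_le_one)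
    have hSK : ∀ t, S t = (K t * G t) • frame L p (smallLoop p w t) := fun t => by
      simp only [K]
      rw [div_mul_cancel₀ _ (Complex.exp_ne_zero _), coeff_smul_frame_eq (hbase t)]
    rw [hSK 1, hSK 0, smul_smul, hK1, hG1]
    rw [show K 0 * (Complex.exp (-(2 * Real.pi * Complex.I * c)) * G 0) =
      Complex.exp (-(2 * Real.pi * Complex.I * c)) * (K 0 * G 0) by ring]
    exact congrArg (fun y => TotalSpace.mk' ℂ y ((Complex.exp (-(2 * Real.pi * Complex.I * c)) *
      (K 0 * G 0)) • frame L p y)) (smallLoop_zero_eq_one p w)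

end Monodromy

/-! ### Roots and inverses of analytic functions -/

section LocalRoot

/-- An analytic function vanishing to the order `n ≠ 0` is the `n`-th power of a local
coordinate. -/
theorem exists_eq_pow_of_analyticOrderAt_eq {F : ℂ → ℂ} {z : ℂ} {n : ℕ} (hn : n ≠ 0)
    (hF : AnalyticAt ℂ F z) (ho : analyticOrderAt F z = n) :
    ∃ φ : ℂ → ℂ, AnalyticAt ℂ φ z ∧ φ z = 0 ∧ deriv φ z ≠ 0 ∧ ∀ᶠ w in 𝓝 z, F w = φ w ^ n := by
  obtain ⟨g, hg, hg0, hFg⟩ := hF.analyticOrderAt_eq_natCast.1 ho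
  -- Dividing by `g z` brings the base of the power to `1` at `z`, away from the branch cut, so that
  -- this root of `g` is analytic there.
  set k : ℂ → ℂ := fun w => (g w / g z) ^ ((n : ℂ)⁻¹) * g z ^ ((n : ℂ)⁻¹) with hk
  have hka : AnalyticAt ℂ k z := by
    refine AnalyticAt.mul (AnalyticAt.cpow (hg.div analyticAt_const hg0) analyticAt_const ?_)
      analyticAt_const
    rw [div_self hg0]
    exact Complex.one_mem_slitPlane
  have hkn : ∀ w, k w ^ n = g w := fun w => by
    rw [hk, mul_pow, Complex.cpow_nat_inv_pow _ hn, Complex.cpow_nat_inv_pow _ hn,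
      div_mul_cancel₀ _ hg0]
  have hk0 : k z ≠ 0 := fun h => hg0 (by rw [← hkn, h, zero_pow hn])
  have hid : HasDerivAt (fun w => w - z) 1 z := (hasDerivAt_id z).sub_const z
  have hd : HasDerivAt (fun w => (w - z) * k w) (k z) z := by
    refine (hid.mul hka.differentiableAt.hasDerivAt).congr_deriv ?_
    simp
  refine ⟨fun w => (w - z) * k w, (analyticAt_id.sub analyticAt_const).mul hka, by simp, ?_, ?_⟩
  · rwa [hd.deriv]
  · filter_upwards [hFg] with w hw
    rw [hw, mul_pow, hkn, smul_eq_mul]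

/-- An analytic function with nonzero derivative has a local inverse. -/
theorem exists_localInverse {φ : ℂ → ℂ} {z : ℂ} (hφ : AnalyticAt ℂ φ z) (hd : deriv φ z ≠ 0) :
    ∃ ψ : ℂ → ℂ, DifferentiableAt ℂ ψ (φ z) ∧ ψ (φ z) = z ∧ (∀ᶠ w in 𝓝 z, ψ (φ w) = w) ∧
      ∀ᶠ v in 𝓝 (φ z), φ (ψ v) = v := by
  have hs : HasStrictDerivAt φ (deriv φ z) z := hφ.hasStrictDerivAt
  refine ⟨hs.localInverse φ _ z hd, (hs.to_localInverse hd).hasDerivAt.differentiableAt, ?_,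
    HasStrictDerivAt.eventually_left_inverse hs hd,
    HasStrictDerivAt.eventually_right_inverse hs hd⟩
  exact (HasStrictDerivAt.eventually_left_inverse hs hd).self_of_nhds

end LocalRoot

/-! ### Double covers: fibres, the involution and its holomorphy -/

section Cover

variable {X Y : Type*} [TopologicalSpace X] [ChartedSpace ℂ X] [IsManifold 𝓘(ℂ) 1 X]
  [TopologicalSpace Y] [ChartedSpace ℂ Y] [IsManifold 𝓘(ℂ) 1 Y]
  {π : Y → X} (hπ : IsDoubleCover π)

include hπ

namespace IsDoubleCover

theorem analyticAt (y : Y) : AnalyticAt ℂ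
    (fun w => chartAt ℂ (π y) (π ((chartAt ℂ y).symm w)) - chartAt ℂ (π y) (π y))
    (chartAt ℂ y y) :=
  (analyticAt_chart (Eventually.of_forall hπ.holomorphic)).sub analyticAt_const

theorem one_le_multiplicity (y : Y) : 1 ≤ multiplicity π y := by
  rw [Order.one_le_iff_ne_zero, multiplicity, (hπ.analyticAt y).analyticOrderAt_ne_zero,
    chart_symm_chart_self, sub_self]

/-- Multiplicities are nonzero, so an infinite fibre would be an infinite support, for which
`finsum` takes the default value `0` instead of `2`. -/
theorem finite_fibre (x : X) : (π ⁻¹' {x}).Finite := by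
  by_contra h
  have h2 := hπ.degree_two x
  rw [finsum_mem_eq_zero_of_infinite] at h2
  · simp at h2
  · rw [Set.inter_eq_left.2]
    · exact h
    intro y _
    exact (zero_lt_one.trans_le (hπ.one_le_multiplicity y)).ne'

theorem sum_multiplicity (x : X) :
    ∑ y ∈ (hπ.finite_fibre x).toFinset, multiplicity π y = 2 := by
  rw [← hπ.degree_two x, finsum_mem_eq_finite_toFinset_sum]

theorem sum_multiplicity_le {x : X} {s : Finset Y} (hs : ∀ y ∈ s, π y = x) :
    ∑ y ∈ s, multiplicity π y ≤ 2 := by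
  rw [← hπ.sum_multiplicity x]
  exact Finset.sum_le_sum_of_subset fun y hy => by simpa using hs y hy

theorem card_le_two {x : X} {s : Finset Y} (hs : ∀ y ∈ s, π y = x) : s.card ≤ 2 := by
  have h := (Finset.sum_le_sum fun y _ => hπ.one_le_multiplicity y).trans
    (hπ.sum_multiplicity_le hs)
  simp only [Finset.sum_const, nsmul_eq_mul, mul_one] at h
  exact_mod_cast h

theorem eq_of_ne {a b c : Y} (hab : a ≠ b) (h : π a = π b) (hc : π c = π b) (hca : c ≠ a) :
    c = b := by
  classical
  by_contra hcb
  have := hπ.card_le_two (x := π b) (s := {a, b, c}) (by simp [h, hc])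
  rw [Finset.card_eq_three.2 ⟨a, b, c, hab, hca.symm, Ne.symm hcb, rfl⟩] at this
  omega

theorem multiplicity_eq_one {a b : Y} (hab : a ≠ b) (h : π a = π b) : multiplicity π a = 1 := by
  classical
  have h1 := hπ.sum_multiplicity_le (x := π b) (s := {a, b}) (by simp [h])
  rw [Finset.sum_pair hab] at h1
  refine le_antisymm ?_ (hπ.one_le_multiplicity a)
  have h2 : multiplicity π a + 1 ≤ 1 + 1 := by
    rw [one_add_one_eq_two]
    exact (add_le_add_right (hπ.one_le_multiplicity b) _).trans h1
  exact (ENat.add_le_add_iff_right ENat.one_ne_top).1 h2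

/-- A fibre has at most two points, so the arbitrary choice in `involution` is forced. Every later
computation of `σ` exhibits a second point of the fibre and appeals to this. -/
theorem involution_eq {a b : Y} (hab : b ≠ a) (h : π b = π a) : involution π a = b := by
  have hex : ∃ y', y' ≠ a ∧ π y' = π a := ⟨b, hab, h⟩
  rw [involution, dif_pos hex]
  exact hπ.eq_of_ne hab.symm h.symm (hex.choose_spec.2.trans h.symm) hex.choose_spec.1

/-- Two distinct points of a fibre share the total `2` as `1 + 1`, while a point alone in its fibre
must carry all of it. -/
theorem exists_ne_iff {a : Y} : (∃ b, b ≠ a ∧ π b = π a) ↔ a ∉ ramification π := by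
  refine ⟨fun ⟨b, hb, h⟩ => ?_, fun ha => ?_⟩
  · simp [ramification, hπ.multiplicity_eq_one hb.symm h.symm]
  · by_contra! hb
    have h1 : multiplicity π a = 1 := le_antisymm (not_lt.1 ha) (hπ.one_le_multiplicity a)
    have h2 := hπ.sum_multiplicity (π a)
    have h3 : (hπ.finite_fibre (π a)).toFinset = {a} := by
      ext b
      simp only [Set.Finite.mem_toFinset, Set.mem_preimage, Set.mem_singleton_iff,
        Finset.mem_singleton]
      exact ⟨fun h => by_contra fun hne => hb b hne h, fun h => by rw [h]⟩
    rw [h3, Finset.sum_singleton, h1] at h2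
    norm_num at h2

theorem involution_of_mem {a : Y} (ha : a ∈ ramification π) : involution π a = a :=
  dif_neg fun h => hπ.exists_ne_iff.1 h ha

theorem involution_spec {a : Y} (ha : a ∉ ramification π) :
    involution π a ≠ a ∧ π (involution π a) = π a := by
  obtain ⟨b, hb, h⟩ := hπ.exists_ne_iff.2 ha
  rw [hπ.involution_eq hb h]
  exact ⟨hb, h⟩

theorem involution_involutive : Function.Involutive (involution π) := fun a => by
  by_cases ha : a ∈ ramification π
  · rw [hπ.involution_of_mem ha, hπ.involution_of_mem ha]
  · exact hπ.involution_eq (hπ.involution_spec ha).1.symm (hπ.involution_spec ha).2.symm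

theorem fibre_eq {a : Y} (ha : a ∉ ramification π) : π ⁻¹' {π a} = {a, involution π a} := by
  ext b
  simp only [Set.mem_preimage, Set.mem_singleton_iff, Set.mem_insert_iff]
  refine ⟨fun h => ?_, ?_⟩
  · by_cases hb : b = a
    · exact Or.inl hb
    · exact Or.inr (hπ.involution_eq hb h).symm
  · rintro (rfl | rfl)
    · rfl
    · exact (hπ.involution_spec ha).2

theorem multiplicity_eq_two {a : Y} (ha : a ∈ ramification π) : multiplicity π a = 2 := by
  have h1 := hπ.sum_multiplicity_le (x := π a) (s := {a}) (by simp)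
  rw [Finset.sum_singleton] at h1
  refine le_antisymm h1 ?_
  rw [← one_add_one_eq_two]
  exact Order.add_one_le_of_lt ha

theorem nonempty_fibre (x : X) : ∃ y, π y = x := by
  by_contra! h
  have h1 := hπ.sum_multiplicity x
  rw [Finset.sum_eq_zero] at h1
  · simp at h1
  · intro y hy
    exact absurd (by simpa using hy) (h y)

/-- In suitable local coordinates, `π` is the map `z ↦ z ^ n`. -/
theorem exists_local_form (y : Y) {n : ℕ} (hn : n ≠ 0) (hy : multiplicity π y = n) :
    ∃ φ ψ : ℂ → ℂ, DifferentiableAt ℂ φ (chartAt ℂ y y) ∧ φ (chartAt ℂ y y) = 0 ∧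
      DifferentiableAt ℂ ψ 0 ∧ ψ 0 = chartAt ℂ y y ∧
      (∀ᶠ w in 𝓝 (chartAt ℂ y y), ψ (φ w) = w) ∧ (∀ᶠ v in 𝓝 0, φ (ψ v) = v) ∧
      ∀ᶠ w in 𝓝 (chartAt ℂ y y),
        chartAt ℂ (π y) (π ((chartAt ℂ y).symm w)) = chartAt ℂ (π y) (π y) + φ w ^ n := by
  obtain ⟨φ, hφ, hφ0, hφd, hF⟩ := exists_eq_pow_of_analyticOrderAt_eq hn (hπ.analyticAt y) hy
  obtain ⟨ψ, h1, h2, h3, h4⟩ := exists_localInverse hφ hφd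
  rw [hφ0] at h1 h2 h4
  refine ⟨φ, ψ, hφ.differentiableAt, hφ0, h1, h2, h3, h4, hF.mono fun w hw => ?_⟩
  rw [← hw, add_sub_cancel]

theorem eventually_mem_source (y : Y) : ∀ᶠ a in 𝓝 y, π a ∈ (chartAt ℂ (π y)).source :=
  (hπ.holomorphic y).continuousAt.eventually (eventually_mem_chart_source (π y))

/-- The other point `y'` of the fibre is unramified, so `π` has a holomorphic local inverse there.
Near `y` the involution is this inverse composed with `π`. -/
theorem mdifferentiableAt_involution_of_notMem [T2Space Y] {y : Y} (hy : y ∉ ramification π) :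
    MDifferentiableAt 𝓘(ℂ) 𝓘(ℂ) (involution π) y := by
  obtain ⟨hne, hy'⟩ := hπ.involution_spec hy
  set y' := involution π y with hy'def
  obtain ⟨φ, ψ, -, hφ0, hψ, hψ0, -, hr, hF⟩ := hπ.exists_local_form y' one_ne_zero
    (by simpa using hπ.multiplicity_eq_one hne hy')
  rw [hy'] at hF
  set x := π y
  set v : Y → ℂ := fun a => chartAt ℂ x (π a) - chartAt ℂ x x with hv
  have hvy : v y = 0 := sub_self _
  have hvd : MDifferentiableAt 𝓘(ℂ) 𝓘(ℂ) v y :=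
    ((mdifferentiableAt_chart (mem_chart_source ℂ x)).comp y (hπ.holomorphic y)).sub
      mdifferentiableAt_const
  set τ : Y → Y := fun a => (chartAt ℂ y').symm (ψ (v a)) with hτ
  have hτy : τ y = y' := by
    rw [hτ]
    simp only [hvy, hψ0, chart_symm_chart_self]
  have hψd : MDifferentiableAt 𝓘(ℂ) 𝓘(ℂ) (ψ ∘ v) y :=
    MDifferentiableAt.comp y (by rw [hvy]; exact hψ.mdifferentiableAt) hvd
  have hτd : MDifferentiableAt 𝓘(ℂ) 𝓘(ℂ) τ y := by
    refine MDifferentiableAt.comp y ?_ hψd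
    simp only [hvy, hψ0]
    exact mdifferentiableAt_chart_symm (mem_chart_source ℂ y')
  refine hτd.congr_of_eventuallyEq ?_
  have hvt : Tendsto v (𝓝 y) (𝓝 0) := by
    have := hvd.continuousAt.tendsto
    rwa [hvy] at this
  have hψt : Tendsto (ψ ∘ v) (𝓝 y) (𝓝 (chartAt ℂ y' y')) := by
    have := hψd.continuousAt.tendsto
    rwa [Function.comp_apply, hvy, hψ0] at this
  have hτt : Tendsto τ (𝓝 y) (𝓝 y') := by
    have := hτd.continuousAt.tendsto
    rwa [hτy] at this
  -- Since `τ y = y' ≠ y`, the values of `τ` remain second points of the fibre near `y`, as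
  -- `involution_eq` requires.
  have hneτ : ∀ᶠ a in 𝓝 y, τ a ≠ a :=
    (hτd.continuousAt.ne_iff_eventually_ne continuousAt_id).1 (by rw [hτy]; exact hne)
  have hsrc := hπ.eventually_mem_source y'
  rw [hy'] at hsrc
  filter_upwards [hneτ, hvt.eventually hr, hψt.eventually hF, hτt.eventually hsrc,
    hπ.eventually_mem_source y] with a h1 h2 h3 h4 h5
  refine hπ.involution_eq h1 ((chartAt ℂ _).injOn h4 h5 ?_)
  simp only [Function.comp_apply, h2, pow_one] at h3
  rw [h3, hv]
  ring

/-- In a coordinate `φ` with `π = φ ^ 2` the involution is `φ ↦ -φ`. It is holomorphic and moves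
every nearby point except `r`, so the nearby points are unramified. -/
theorem involution_near_ramification {r : Y} (hr : r ∈ ramification π) :
    MDifferentiableAt 𝓘(ℂ) 𝓘(ℂ) (involution π) r ∧ ∀ᶠ a in 𝓝[≠] r, a ∉ ramification π := by
  obtain ⟨φ, ψ, hφ, hφ0, hψ, hψ0, hl, hR, hF⟩ := hπ.exists_local_form r two_ne_zero
    (hπ.multiplicity_eq_two hr)
  set v : Y → ℂ := fun a => -φ (chartAt ℂ r a) with hv
  have hvr : v r = 0 := by simp [hv, hφ0]
  have hvd : MDifferentiableAt 𝓘(ℂ) 𝓘(ℂ) v r :=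
    (hφ.neg.mdifferentiableAt).comp r (mdifferentiableAt_chart (mem_chart_source ℂ r))
  set τ : Y → Y := fun a => (chartAt ℂ r).symm (ψ (v a)) with hτ
  have hτr : τ r = r := by
    rw [hτ]
    simp only [hvr, hψ0, chart_symm_chart_self]
  have hψd : MDifferentiableAt 𝓘(ℂ) 𝓘(ℂ) (ψ ∘ v) r :=
    MDifferentiableAt.comp r (by rw [hvr]; exact hψ.mdifferentiableAt) hvd
  have hτd : MDifferentiableAt 𝓘(ℂ) 𝓘(ℂ) τ r := by
    refine MDifferentiableAt.comp r ?_ hψd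
    simp only [hvr, hψ0]
    exact mdifferentiableAt_chart_symm (mem_chart_source ℂ r)
  have hvt : Tendsto v (𝓝 r) (𝓝 0) := by
    have := hvd.continuousAt.tendsto
    rwa [hvr] at this
  have hψt : Tendsto (ψ ∘ v) (𝓝 r) (𝓝 (chartAt ℂ r r)) := by
    have := hψd.continuousAt.tendsto
    rwa [Function.comp_apply, hvr, hψ0] at this
  have hτt : Tendsto τ (𝓝 r) (𝓝 r) := by
    have := hτd.continuousAt.tendsto
    rwa [hτr] at this
  have hct : Tendsto (chartAt ℂ r) (𝓝 r) (𝓝 (chartAt ℂ r r)) :=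
    (chartAt ℂ r).continuousAt (mem_chart_source ℂ r)
  have key : ∀ᶠ a in 𝓝 r, a ≠ r → τ a ≠ a ∧ π (τ a) = π a := by
    filter_upwards [hvt.eventually hR, hψt.eventually hF, hct.eventually hF,
      hτt.eventually (hπ.eventually_mem_source r), hπ.eventually_mem_source r,
      hct.eventually hl, eventually_mem_chart_source r,
      hψt.eventually (eventually_mem_chart_target r)] with a h1 h2 h3 h4 h5 h6 h7 h8 har
    have hφa : φ (chartAt ℂ r a) ≠ 0 := fun h => har <| by
      rw [h, hψ0] at h6
      exact (chartAt ℂ r).injOn h7 (mem_chart_source ℂ r) h6.symm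
    refine ⟨fun h => ?_, (chartAt ℂ _).injOn h4 h5 ?_⟩
    · have h9 : chartAt ℂ r (τ a) = ψ (v a) := (chartAt ℂ r).right_inv h8
      rw [← h9, h, hv] at h1
      exact hφa (self_eq_neg.1 h1)
    · rw [(chartAt ℂ r).left_inv h7] at h3
      rw [h3]
      simp only [Function.comp_apply] at h2
      rw [h2, h1, hv]
      simp
  refine ⟨hτd.congr_of_eventuallyEq ?_, ?_⟩
  · filter_upwards [key] with a ha
    by_cases har : a = r
    · rw [har, hτr, hπ.involution_of_mem hr]
    · exact hπ.involution_eq (ha har).1 (ha har).2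
  · rw [eventually_nhdsWithin_iff]
    filter_upwards [key] with a ha har
    exact hπ.exists_ne_iff.1 ⟨_, ha har⟩

theorem mdifferentiable_involution [T2Space Y] :
    MDifferentiable 𝓘(ℂ) 𝓘(ℂ) (involution π) := fun y => by
  by_cases hy : y ∈ ramification π
  · exact (hπ.involution_near_ramification hy).1
  · exact hπ.mdifferentiableAt_involution_of_notMem hy

/-- At an unramified `q` the involution moves `q`, hence by continuity all nearby points, whereas it
fixes ramification points. -/
theorem eventually_notMem_ramification [T2Space Y] (q : Y) :
    ∀ᶠ a in 𝓝[≠] q, a ∉ ramification π := by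
  by_cases hq : q ∈ ramification π
  · exact (hπ.involution_near_ramification hq).2
  · have h := ((hπ.mdifferentiable_involution q).continuousAt.ne_iff_eventually_ne
      continuousAt_id).1 (hπ.involution_spec hq).1
    filter_upwards [nhdsWithin_le_nhds h] with a ha ha'
    exact ha (hπ.involution_of_mem ha')

theorem eventually_notMem_poles [T2Space Y] {D : Set X} (hD : D.Finite) (q : Y) :
    ∀ᶠ a in 𝓝[≠] q, a ∉ ramification π ∪ π ⁻¹' D := by
  have hfin : (π ⁻¹' D \ {q}).Finite := (hD.preimage' fun x _ => hπ.finite_fibre x).sdiff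
  have h : ∀ᶠ a in 𝓝 q, a ∉ π ⁻¹' D \ {q} :=
    hfin.isClosed.isOpen_compl.mem_nhds fun h => h.2 rfl
  filter_upwards [nhdsWithin_le_nhds h, hπ.eventually_notMem_ramification q,
    self_mem_nhdsWithin] with a h1 h2 h3
  rintro (h4 | h4)
  · exact h2 h4
  · exact h1 ⟨h4, h3⟩

end IsDoubleCover

end Cover

/-! ### Residues of a logarithmic derivative -/

section LogDeriv

/-- Comparison of residues: if `z ^ n F` is holomorphic and nonzero, and the logarithmic derivative
of `F` is `z⁻¹ h dz + s⁻¹ k ds`, where `s` is another local coordinate, then `h + k = -n`. -/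
theorem add_eq_neg_of_deriv_eq {F G s h k : ℂ → ℂ} {z : ℂ} {n : ℕ} (hG : AnalyticAt ℂ G z)
    (hG0 : G z ≠ 0) (hs : AnalyticAt ℂ s z) (hs0 : s z = 0) (hsd : deriv s z ≠ 0)
    (hh : ContinuousAt h z) (hk : ContinuousAt k z)
    (hFG : ∀ᶠ w in 𝓝[≠] z, (w - z) ^ n * F w = G w)
    (hF : ∀ᶠ w in 𝓝[≠] z, deriv F w = (h w / (w - z) + deriv s w * (k w / s w)) * F w) :
    h z + k z = -n := by
  set A : ℂ → ℂ := fun w => h w + deriv s w * k w * (slope s z w)⁻¹ with hA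
  -- This is `z` times the derivative of `G = z ^ n F`, with `z` for `w - z`. At the centre the
  -- right side tends to `0`, while `A` tends to `h z + k z` because `slope s z` tends to `deriv s
  -- z`.
  have key : ∀ᶠ w in 𝓝[≠] z, (n + A w) * G w = (w - z) * deriv G w := by
    filter_upwards [eventually_eventually_nhdsWithin.2 hFG, hF, hFG, self_mem_nhdsWithin,
      nhdsWithin_le_nhds hG.eventually_analyticAt] with w h1 h2 h3 hwz hGw
    have hwz' : w - z ≠ 0 := sub_ne_zero.2 hwz
    have h1' : ∀ᶠ u in 𝓝 w, (u - z) ^ n * F u = G u := by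
      rwa [nhdsWithin_eq_nhds.2 (isOpen_compl_singleton.mem_nhds hwz)] at h1
    have hid : HasDerivAt (fun u => u - z) 1 w := (hasDerivAt_id w).sub_const z
    have hpow := hid.pow n
    have hFd : DifferentiableAt ℂ F w := by
      have : DifferentiableAt ℂ (fun u => G u / (u - z) ^ n) w :=
        hGw.differentiableAt.div hpow.differentiableAt (pow_ne_zero n hwz')
      refine this.congr_of_eventuallyEq ?_
      filter_upwards [h1', isOpen_ne.mem_nhds hwz] with u hu huz
      rw [← hu, mul_div_cancel_left₀ _ (pow_ne_zero n (sub_ne_zero.2 huz))]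
    have hGd := ((hpow.mul hFd.hasDerivAt).congr_of_eventuallyEq
      (h1'.mono fun u hu => hu.symm)).deriv
    -- For `n = 0` the exponent `n - 1` is truncated, but the factor `n` vanishes.
    have hpn : (w - z) * (n * (w - z) ^ (n - 1) * 1) = n * (w - z) ^ n := by
      rcases n with _ | n
      · simp
      · rw [pow_succ]
        simp
        ring
    have hslope : (w - z) * (deriv s w * (k w / s w)) = deriv s w * k w * (slope s z w)⁻¹ := by
      rw [slope_def_field, hs0, sub_zero, inv_div]
      ring
    have hh' : (w - z) * (h w / (w - z)) = h w := mul_div_cancel₀ _ hwz'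
    rw [hGd, ← h3, h2]
    simp only [hA, Pi.pow_apply]
    rw [← hslope]
    linear_combination (-F w) * hpn - (w - z) ^ n * F w * hh'
  have hsl : Tendsto (slope s z) (𝓝[≠] z) (𝓝 (deriv s z)) :=
    hasDerivAt_iff_tendsto_slope.1 hs.differentiableAt.hasDerivAt
  have hAt : Tendsto A (𝓝[≠] z) (𝓝 (h z + deriv s z * k z * (deriv s z)⁻¹)) :=
    (hh.tendsto.mono_left nhdsWithin_le_nhds).add
      (((hs.deriv.continuousAt.tendsto.mono_left nhdsWithin_le_nhds).mul
        (hk.tendsto.mono_left nhdsWithin_le_nhds)).mul (hsl.inv₀ hsd))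
  have hl := (hAt.const_add (n : ℂ)).mul
    (hG.continuousAt.tendsto.mono_left (nhdsWithin_le_nhds (s := {z}ᶜ)))
  have hr : Tendsto (fun w => (w - z) * deriv G w) (𝓝[≠] z) (𝓝 ((z - z) * deriv G z)) :=
    ((continuousAt_id.sub continuousAt_const).mul hG.deriv.continuousAt).tendsto.mono_left
      nhdsWithin_le_nhds
  have h3 := tendsto_nhds_unique (hl.congr' key) hr
  rw [sub_self, zero_mul, mul_eq_zero, or_iff_left hG0, mul_comm (deriv s z),
    mul_inv_cancel_right₀ hsd] at h3
  linear_combination h3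

end LogDeriv

/-! ### The pairing of frames and the sum of residues -/

section Odd

variable {Y : Type*} [TopologicalSpace Y] [ChartedSpace ℂ Y] [IsManifold 𝓘(ℂ) 1 Y]
  {L : Y → Type*} [TopologicalSpace (TotalSpace ℂ L)]
  [∀ y, AddCommGroup (L y)] [∀ y, Module ℂ (L y)] [∀ y, TopologicalSpace (L y)]
  [∀ y, IsTopologicalAddGroup (L y)] [∀ y, ContinuousSMul ℂ (L y)]
  [FiberBundle ℂ L] [VectorBundle ℂ ℂ L]

variable [ContMDiffVectorBundle 1 ℂ L 𝓘(ℂ)] {P R : Set Y} {δ : LogConnection L P} {σ : Y → Y}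

/-- A tangent vector at `σ y` is determined by its image under the differential of the coordinate
there, which the chain rule computes. The factor is the derivative of `z' ∘ σ` that appears when
pulling back `dz' / z'`. -/
theorem mfderiv_coordField (hσ : MDifferentiable 𝓘(ℂ) 𝓘(ℂ) σ) {q y : Y}
    (hy : y ∈ (chartAt ℂ q).source) (hσy : σ y ∈ (chartAt ℂ (σ q)).source) :
    mfderiv 𝓘(ℂ) 𝓘(ℂ) σ y (coordField q y) =
      deriv ((localCoord (σ q) ∘ σ) ∘ (chartAt ℂ q).symm) (chartAt ℂ q y) •
        coordField (σ q) (σ y) := by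
  have hl : MDifferentiableAt 𝓘(ℂ) 𝓘(ℂ) (localCoord (σ q)) (σ y) :=
    (mdifferentiableAt_chart hσy).sub mdifferentiableAt_const
  obtain ⟨c, hc⟩ := exists_eq_smul_coordField hσy (mfderiv 𝓘(ℂ) 𝓘(ℂ) σ y (coordField q y))
  have h1 : mvfderiv 𝓘(ℂ) (localCoord (σ q) ∘ σ) y (coordField q y) =
      mvfderiv 𝓘(ℂ) (localCoord (σ q)) (σ y) (mfderiv 𝓘(ℂ) 𝓘(ℂ) σ y (coordField q y)) :=
    congrArg (fun A => A (coordField q y)) (mfderiv_comp (I := 𝓘(ℂ)) (I'' := 𝓘(ℂ)) y hl (hσ y))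
  rw [mvfderiv_coordField hy (hl.comp y (hσ y)), hc, map_smul, mvfderiv_localCoord hσy,
    smul_eq_mul, mul_one] at h1
  rw [hc, h1]

/-- As `σ ∘ σ` is the identity, its differential cannot factor through zero. Hence `z' ∘ σ` is a
local coordinate at `q`. -/
theorem deriv_localCoord_comp_ne_zero (hσ : MDifferentiable 𝓘(ℂ) 𝓘(ℂ) σ)
    (hσσ : Function.Involutive σ) (q : Y) :
    deriv ((localCoord (σ q) ∘ σ) ∘ (chartAt ℂ q).symm) (chartAt ℂ q q) ≠ 0 := by
  intro h0
  have h1 := mfderiv_coordField hσ (mem_chart_source ℂ q) (mem_chart_source ℂ (σ q))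
  rw [h0, zero_smul] at h1
  have h2 : mvfderiv 𝓘(ℂ) (localCoord q) q (coordField q q) =
      mvfderiv 𝓘(ℂ) (localCoord q ∘ σ) (σ q) (mfderiv 𝓘(ℂ) 𝓘(ℂ) σ q (coordField q q)) := by
    have hl : MDifferentiableAt 𝓘(ℂ) 𝓘(ℂ) (localCoord q ∘ σ) (σ q) := by
      refine MDifferentiableAt.comp (σ q) ?_ (hσ (σ q))
      rw [hσσ q]
      exact (mdifferentiableAt_chart (mem_chart_source ℂ q)).sub mdifferentiableAt_const
    have h3 : (localCoord q ∘ σ) ∘ σ = localCoord q := by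
      funext y
      simp [hσσ y]
    have h4 := mfderiv_comp (I := 𝓘(ℂ)) (I'' := 𝓘(ℂ)) q hl (hσ q)
    rw [h3] at h4
    exact congrArg (fun A => A (coordField q q)) h4
  rw [mvfderiv_localCoord (mem_chart_source ℂ q), h1, map_zero] at h2
  exact one_ne_zero h2

theorem IsConnectionForm.eventually_eq {q : Y} {h : ℂ → ℂ} (hδ : IsConnectionForm δ q h) :
    ∀ᶠ y in 𝓝[≠] q, δ.toFun (frame L q) y (coordField q y) =
      (h (chartAt ℂ q y) / localCoord q y) • frame L q y := by
  filter_upwards [hδ.2, (tendsto_chart_punctured q).eventually self_mem_nhdsWithin] with y hy hy'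
  have h0 : localCoord q y ≠ 0 := sub_ne_zero.2 hy'
  rw [div_eq_inv_mul, mul_smul, ← hy, inv_smul_smul₀ h0]

namespace OddStructure

/-- The function `μ (a ⊗ σ^* b)`, where `a` and `b` are the local frames at `q` and `σ q`. -/
def pairing (μ : OddStructure δ σ R) (q y : Y) : ℂ :=
  μ.μ y (tensorPullback σ (frame L q) (frame L (σ q)) y)

variable (L) in
/-- The set where both the local frame at `q` and the pullback of the one at `σ q` are defined. -/
def pairingDomain (σ : Y → Y) (q : Y) : Set Y :=
  (trivializationAt ℂ L q).baseSet ∩ σ ⁻¹' (trivializationAt ℂ L (σ q)).baseSet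

theorem isOpen_pairingDomain (hσ : Continuous σ) (q : Y) : IsOpen (pairingDomain L σ q) :=
  (trivializationAt ℂ L q).open_baseSet.inter
    ((trivializationAt ℂ L (σ q)).open_baseSet.preimage hσ)

theorem mem_pairingDomain (q : Y) : q ∈ pairingDomain L σ q :=
  ⟨FiberBundle.mem_baseSet_trivializationAt' q, FiberBundle.mem_baseSet_trivializationAt' (σ q)⟩

theorem preimage_pairingDomain_subset (hσσ : Function.Involutive σ) (q : Y) :
    σ ⁻¹' pairingDomain L σ q ⊆ (trivializationAt ℂ L (σ q)).baseSet := fun y hy => by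
  have := hy.2
  rwa [Set.mem_preimage, hσσ y] at this

/-- The frames vanish nowhere on the domain, so `map_generator` applies. This fixes the order of the
pairing, and also yields its differentiability off `R`. -/
theorem isGeneratorO_pairing (μ : OddStructure δ σ R) (hσ : Continuous σ)
    (hσσ : Function.Involutive σ) (q : Y) : IsGeneratorO R (pairingDomain L σ q) (μ.pairing q) :=
  μ.map_generator _ _ _ (isOpen_pairingDomain hσ q) (fun _ hy => secDiffAt_frame hy.1)
    (fun _ hy => secDiffAt_frame (preimage_pairingDomain_subset hσσ q hy))
    (fun _ hy => frame_ne_zero hy.1)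
    (fun _ hy => frame_ne_zero (preimage_pairingDomain_subset hσσ q hy))

theorem mvfderiv_pairing (μ : OddStructure δ σ R) (hσ : Continuous σ)
    (hσσ : Function.Involutive σ) {q y : Y} (hy : y ∈ pairingDomain L σ q) (hyP : y ∉ R ∪ P)
    (v : TangentSpace 𝓘(ℂ) y) :
    mvfderiv 𝓘(ℂ) (μ.pairing q) y v =
      μ.μ y (tensorPullbackConnection δ σ (frame L q) (frame L (σ q)) y v) :=
  μ.intertwines _ _ _ (isOpen_pairingDomain hσ q) (fun _ hy => secDiffAt_frame hy.1)
    (fun _ hy => secDiffAt_frame (preimage_pairingDomain_subset hσσ q hy)) y ⟨hy, hyP⟩ v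

/-- The logarithmic derivative of the pairing is the sum of the connection forms of `δ` and
`σ^* δ`; compare residues. -/
theorem add_eq_neg (μ : OddStructure δ σ R) (hσ : MDifferentiable 𝓘(ℂ) 𝓘(ℂ) σ)
    (hσσ : Function.Involutive σ) {q : Y} {h k : ℂ → ℂ} (hh : IsConnectionForm δ q h)
    (hk : IsConnectionForm δ (σ q) k) (hRP : ∀ᶠ y in 𝓝[≠] q, y ∉ R ∪ P) {n : ℕ} {g : Y → ℂ}
    (hg : ∀ᶠ y in 𝓝 q, MDifferentiableAt 𝓘(ℂ) 𝓘(ℂ) g y) (hg0 : g q ≠ 0)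
    (hgn : ∀ᶠ y in 𝓝[≠] q, g y = localCoord q y ^ n * μ.pairing q y) :
    h (chartAt ℂ q q) + k (chartAt ℂ (σ q) (σ q)) = -n := by
  set e := chartAt ℂ q
  set e' := chartAt ℂ (σ q)
  have hσt : Tendsto σ (𝓝[≠] q) (𝓝[≠] (σ q)) :=
    tendsto_nhdsWithin_iff.2 ⟨((hσ q).continuousAt.tendsto).mono_left nhdsWithin_le_nhds,
      eventually_mem_nhdsWithin.mono fun y hy h => hy (hσσ.injective h)⟩
  have hsrc' : ∀ᶠ y in 𝓝 q, σ y ∈ e'.source :=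
    (hσ q).continuousAt.eventually (eventually_mem_chart_source (σ q))
  have hs : AnalyticAt ℂ ((localCoord (σ q) ∘ σ) ∘ e.symm) (e q) :=
    analyticAt_comp_chart_symm <| hsrc'.mono fun y hy =>
      ((mdifferentiableAt_chart hy).sub mdifferentiableAt_const).comp y (hσ y)
  have hlog : ∀ᶠ y in 𝓝[≠] q, deriv (μ.pairing q ∘ e.symm) (e y) =
      (h (e y) / localCoord q y + deriv ((localCoord (σ q) ∘ σ) ∘ e.symm) (e y) *
        (k (e' (σ y)) / localCoord (σ q) (σ y))) * μ.pairing q y := by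
    filter_upwards [hh.eventually_eq, hσt.eventually hk.eventually_eq, hRP,
      nhdsWithin_le_nhds hsrc', nhdsWithin_le_nhds (eventually_mem_chart_source q),
      nhdsWithin_le_nhds ((isOpen_pairingDomain hσ.continuous q).mem_nhds (mem_pairingDomain (L := L) q))]
      with y h1 h2 h3 h4 h5 h6
    have hd := ((μ.isGeneratorO_pairing hσ.continuous hσσ q).1 y
      ⟨h6, fun h => h3 (Or.inl h)⟩).1
    have h7 := μ.mvfderiv_pairing hσ.continuous hσσ h6 h3 (coordField q y)
    -- Both terms of the tensor product connection are multiples of the same tensor `e ⊗ σ^* e'`, so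
    -- `μ` turns their sum into a multiple of the pairing.
    rw [mvfderiv_coordField h5 hd, tensorPullbackConnection, mfderiv_coordField hσ h5 h4, map_smul,
      h1, h2, smul_smul, TensorProduct.tmul_smul, ← TensorProduct.smul_tmul', ← add_smul,
      map_smul] at h7
    exact h7
  have hright : ∀ᶠ w in 𝓝[≠] (e q), e (e.symm w) = w :=
    nhdsWithin_le_nhds ((eventually_mem_chart_target q).mono fun w hw => e.right_inv hw)
  have hsymm : e.symm (e q) = q := chart_symm_chart_self q
  have hkc : ContinuousAt (k ∘ e' ∘ σ ∘ e.symm) (e q) := by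
    have h1 : ContinuousAt (e' ∘ σ) q :=
      (e'.continuousAt (mem_chart_source ℂ (σ q))).comp (hσ q).continuousAt
    have h2 : ContinuousAt (k ∘ e' ∘ σ) q :=
      ContinuousAt.comp (f := e' ∘ σ) (g := k) hk.1.continuousAt h1
    have h3 : ContinuousAt e.symm (e q) := e.continuousAt_symm (e.map_source (mem_chart_source ℂ q))
    exact ContinuousAt.comp (g := k ∘ e' ∘ σ) (by rwa [hsymm]) h3
  have hFG : ∀ᶠ w in 𝓝[≠] (e q), (w - e q) ^ n * (μ.pairing q ∘ e.symm) w = (g ∘ e.symm) w := by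
    filter_upwards [(tendsto_chart_symm_punctured q).eventually hgn, hright] with w h1 h2
    rw [Function.comp_apply, Function.comp_apply, h1, localCoord, h2]
  have hF : ∀ᶠ w in 𝓝[≠] (e q), deriv (μ.pairing q ∘ e.symm) w =
      (h w / (w - e q) + deriv ((localCoord (σ q) ∘ σ) ∘ e.symm) w *
        ((k ∘ e' ∘ σ ∘ e.symm) w / ((localCoord (σ q) ∘ σ) ∘ e.symm) w)) *
        (μ.pairing q ∘ e.symm) w := by
    filter_upwards [(tendsto_chart_symm_punctured q).eventually hlog, hright] with w h1 h2
    rw [h2, localCoord, h2] at h1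
    exact h1
  have := add_eq_neg_of_deriv_eq (analyticAt_comp_chart_symm hg)
    (by rwa [Function.comp_apply, hsymm]) hs
    (by rw [Function.comp_apply, hsymm]; exact sub_self _)
    (deriv_localCoord_comp_ne_zero hσ hσσ q) hh.1.continuousAt hkc hFG hF
  have hval : (k ∘ e' ∘ σ ∘ e.symm) (e q) = k (e' (σ q)) := by
    rw [Function.comp_apply, Function.comp_apply, Function.comp_apply, hsymm]
  rw [← hval]
  exact this

/-- At a point of `R` the residues at `q` and `σ q` add up to `-1`. -/
theorem add_eq_neg_one (μ : OddStructure δ σ R) (hσ : MDifferentiable 𝓘(ℂ) 𝓘(ℂ) σ)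
    (hσσ : Function.Involutive σ) {q : Y} {h k : ℂ → ℂ} (hh : IsConnectionForm δ q h)
    (hk : IsConnectionForm δ (σ q) k) (hRP : ∀ᶠ y in 𝓝[≠] q, y ∉ R ∪ P) (hq : q ∈ R) :
    h (chartAt ℂ q q) + k (chartAt ℂ (σ q) (σ q)) = -1 := by
  obtain ⟨g, hg, hg0⟩ :=
    (μ.isGeneratorO_pairing hσ.continuous hσσ q).2 q ⟨mem_pairingDomain q, hq⟩
  simpa using μ.add_eq_neg hσ hσσ hh hk hRP (n := 1) hg.1 hg0 (by simpa using hg.2)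

/-- Away from `R` the residues at `q` and `σ q` add up to `0`. -/
theorem add_eq_zero (μ : OddStructure δ σ R) (hσ : MDifferentiable 𝓘(ℂ) 𝓘(ℂ) σ)
    (hσσ : Function.Involutive σ) {q : Y} {h k : ℂ → ℂ} (hh : IsConnectionForm δ q h)
    (hk : IsConnectionForm δ (σ q) k) (hRP : ∀ᶠ y in 𝓝[≠] q, y ∉ R ∪ P) (hq : q ∉ R) :
    h (chartAt ℂ q q) + k (chartAt ℂ (σ q) (σ q)) = 0 := by
  have hgen := (μ.isGeneratorO_pairing hσ.continuous hσσ q).1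
  -- No point of `R` is near `q`, so the pairing itself serves as the holomorphic unit, with `n =
  -- 0`.
  have hR : ∀ᶠ y in 𝓝 q, y ∉ R := by
    filter_upwards [eventually_nhdsWithin_iff.1 hRP] with y hy hyR
    by_cases hyq : y = q
    · exact hq (hyq ▸ hyR)
    · exact hy hyq (Or.inl hyR)
  have hg : ∀ᶠ y in 𝓝 q, MDifferentiableAt 𝓘(ℂ) 𝓘(ℂ) (μ.pairing q) y := by
    filter_upwards [hR, (isOpen_pairingDomain hσ.continuous q).mem_nhds
      (mem_pairingDomain (L := L) q)] with y h1 h2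
    exact (hgen y ⟨h2, h1⟩).1
  simpa using μ.add_eq_neg hσ hσσ hh hk hRP (n := 0) hg (hgen q ⟨mem_pairingDomain q, hq⟩).2
    (by simp)

end OddStructure

end Odd

end OddConn

end

/-! ### Residues and monodromy of an odd connection -/

theorem proposition181116155648
    {X Y : Type*}
    [TopologicalSpace X] [ChartedSpace ℂ X] [IsManifold 𝓘(ℂ) 1 X]
    [CompactSpace X] [T2Space X] [ConnectedSpace X]
    [TopologicalSpace Y] [ChartedSpace ℂ Y] [IsManifold 𝓘(ℂ) 1 Y]
    [CompactSpace Y] [T2Space Y]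
    (π : Y → X) (hπ : OddConn.IsDoubleCover π)
    (D : Set X) (hD : D.Finite)
    (hBD : Disjoint (π '' OddConn.ramification π) D)
    {L : Y → Type*} [TopologicalSpace (TotalSpace ℂ L)]
    [∀ y, AddCommGroup (L y)] [∀ y, Module ℂ (L y)] [∀ y, TopologicalSpace (L y)]
    [∀ y, IsTopologicalAddGroup (L y)] [∀ y, ContinuousSMul ℂ (L y)]
    [FiberBundle ℂ L] [VectorBundle ℂ ℂ L] [ContMDiffVectorBundle 1 ℂ L 𝓘(ℂ)]
    (δ : OddConn.LogConnection L (OddConn.ramification π ∪ π ⁻¹' D))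
    (μ : OddConn.OddStructure δ (OddConn.involution π) (OddConn.ramification π)) :
    (∀ r ∈ OddConn.ramification π,
      OddConn.HasResidueAt δ r (-1 / 2) ∧ OddConn.HasMonodromyAt δ r (-1)) ∧
    ∀ p ∈ D, ∃ q₁ q₂ : Y, q₁ ≠ q₂ ∧ π ⁻¹' {p} = {q₁, q₂} ∧
      ∃ c₁ c₂ : ℂ, OddConn.HasResidueAt δ q₁ c₁ ∧ OddConn.HasResidueAt δ q₂ c₂ ∧ c₁ + c₂ = 0 := by
  have hσ := hπ.mdifferentiable_involution
  have hσσ := hπ.involution_involutive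
  have hP := hπ.eventually_notMem_poles hD
  have hRP : ∀ q, ∀ᶠ y in 𝓝[≠] q, y ∉ OddConn.ramification π ∪
      (OddConn.ramification π ∪ π ⁻¹' D) := fun q => by
    simpa only [← Set.union_assoc, Set.union_self] using hP q
  refine ⟨fun r hr => ?_, fun p hp => ?_⟩
  · obtain ⟨h, hh⟩ := OddConn.exists_isConnectionForm δ (p := r) (Or.inl hr)
    -- Since `σ r = r`, one connection form serves for both points, and the sum `-1` is twice the
    -- residue.
    have hk : OddConn.IsConnectionForm δ (OddConn.involution π r) h := by
      rwa [hπ.involution_of_mem hr]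
    have hsum := μ.add_eq_neg_one hσ hσσ hh hk (hRP r) hr
    rw [hπ.involution_of_mem hr] at hsum
    have hres : h (chartAt ℂ r r) = -1 / 2 := by linear_combination hsum / 2
    have h1 := hh.hasResidueAt (Or.inl hr) (hP r)
    have h2 := hh.hasMonodromyAt (hP r)
    rw [hres] at h1 h2
    rw [show -(2 * (Real.pi : ℂ) * Complex.I * (-1 / 2)) = Real.pi * Complex.I by ring,
      Complex.exp_pi_mul_I] at h2
    exact ⟨h1, h2⟩
  · obtain ⟨q, hq⟩ := hπ.nonempty_fibre p
    have hqR : q ∉ OddConn.ramification π := fun hR =>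
      Set.disjoint_left.1 hBD ⟨q, hR, hq⟩ hp
    have hqD : q ∈ π ⁻¹' D := by rwa [Set.mem_preimage, hq]
    obtain ⟨hne, hπq⟩ := hπ.involution_spec hqR
    have hqD' : OddConn.involution π q ∈ π ⁻¹' D := by rwa [Set.mem_preimage, hπq, hq]
    obtain ⟨h, hh⟩ := OddConn.exists_isConnectionForm δ (p := q) (Or.inr hqD)
    obtain ⟨k, hk⟩ := OddConn.exists_isConnectionForm δ (Or.inr hqD')
    refine ⟨q, OddConn.involution π q, hne.symm, hq ▸ hπ.fibre_eq hqR, _, _,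
      hh.hasResidueAt (Or.inr hqD) (hP q), hk.hasResidueAt (Or.inr hqD') (hP _),
      μ.add_eq_zero hσ hσσ hh hk (hRP q) hqR⟩
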